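/- \textbf{Setting.} Let $n\ge 2$ and realise $\mathfrak{so}(2n,\mathbb C)$ (type $D_n$) as the Lie algebra of $2n\times 2n$ complex matrices that are skew for the symmetric bilinear form with matrix $\begin{pmatrix}0&1\\1&0\end{pmatrix}$; its compact real form $\mathfrak{so}(2n)$ consists of the skew-Hermitian elements, and $Spin(2n)$ is the compact spin group, with Lie algebra $\mathfrak{so}(2n)$ and unit element $e$. Let $E_k=\sqrt{-1}\,(e_{k,k}-e_{n+k,n+k})$, where $e_{j,j}$ are the diagonal matrix units, and let $\mathfrak t=\{\sum_k a_kE_k: a_k\in\mathbb R\}$ be the corresponding maximal torus. Let $L_i\in\sqrt{-1}\,\mathfrak t^*$ be given by $L_i(E_j)=\sqrt{-1}\,\delta_{ij}$, and take the positive roots $\Delta^+=\{L_i\pm L_j: i<j\}$. The basis of $\mathfrak t$ dual to the simple roots $\alpha_i=L_i-L_{i+1}$ ($1\le i\le n-1$), $\alpha_n=L_{n-1}+L_n$ (that is, $\alpha_i(H_j)=\sqrt{-1}\,\delta_{ij}$) is $$H_i=E_1+\dots+E_i\ (1\le i\le n-2),\quad H_{n-1}=\tfrac12(E_1+\dots+E_{n-1}-E_n),\quad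 H_n=\tfrac12(E_1+\dots+E_{n-1}+E_n).$$ Let $\mathfrak I=\{\xi\in\mathfrak t:\exp_{Spin(2n)}(2\pi\xi)=e\}$ be the integer lattice, and let $\mathfrak I'$ be the set of $\xi\in\mathfrak I$ with $\alpha(\xi)\in\sqrt{-1}\,[0,\infty)$ for all $\alpha\in\Delta^+$. For $\xi\in\mathfrak I'$ and $i\in\mathbb Z$, let $\mathfrak g_i^\xi$ be the $\sqrt{-1}\,i$-eigenspace of $\mathrm{ad}\,\xi$ on $\mathfrak{so}(2n,\mathbb C)$ and $\mathfrak p_i^\xi=\bigoplus_{j\le i}\mathfrak g_j^\xi$; write $\xi\preceq\xi'$ if $\mathfrak p_i^{\xi}\subseteq\mathfrak p_i^{\xi'}$ for all $i\ge0$. For $I\subseteq\{1,\dots,n\}$ let $\mathfrak C_I=\{\sum_{i=1}^n c_iH_i: c_i\ge 0,\ c_j=0\text{ iff }j\notin I\}$. An \emph{$I$-canonical element} of $Spin(2n)$ is a maximal element of $(\mathfrak I'\cap\mathfrak C_I,\preceq)$: an element $\xi$ of this set such that $\xi\preceq\xi'$ with $\xi'$ in this set implies $\xi=\xi'$. \textbf{Theorem.}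 Let $n\ge2$, $I\subseteq\{1,\dots,n\}$, $\xi_I=\sum_{i\in I}H_i$, $I_0=I\cap\{1,\dots,n-2\}$, $T=I\cap\{n-1,n\}$ and $\sigma=\sum_{i\in I_0}i$. The $I$-canonical elements of $Spin(2n)$ are precisely the following, where $j$ runs over all odd elements of $I_0$ and $s$ over all elements of $T$. If $n$ is odd: \begin{itemize} \item[a)] for $\sigma$ even: $\xi_I$ if $|T|=0$ or $|T|=2$; $\ \xi_I+3H_s$ and $\xi_I+H_s+H_j$ if $|T|=1$; \item[b)] for $\sigma$ odd: $\xi_I+H_j$ if $|T|=0$; $\ \xi_I+H_s$ if $|T|=1$; $\ \xi_I+2H_s$ and $\xi_I+H_j$ if $|T|=2$. \end{itemize} If $n$ is even: \begin{itemize} \item[a)] for $\sigma$ even: $\xi_I$ if $|T|=0$; $\ \xi_I+H_s$ if $|T|=1$; $\ \xi_I+H_j$ and $\xi_I+H_{n-1}+H_n$ if $|T|=2$; \item[b)] for $\sigma$ odd: $\xi_I+H_j$ if $|T|=0$; $\ \xi_I+H_s+H_j$ if $|T|=1$; $\ \xi_I$ if $|T|=2$. \end{itemize} -/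

import Mathlib

open scoped Matrix

namespace SpinCanonical

noncomputable section

attribute [local instance] LieRing.ofAssociativeRing

/-- The index set `{1, …, n}`. -/
abbrev Idx (n : ℕ) : Type := ↥(Finset.Icc 1 n)

/-- Complex matrices of size `2n`; rows and columns are indexed by two copies of `{1, …, n}`. -/
abbrev Mat (n : ℕ) : Type := Matrix (Idx n ⊕ Idx n) (Idx n ⊕ Idx n) ℂ

/-- The complex Lie algebra `𝔰𝔬(2n, ℂ)` of type `D_n`: the matrices that are skew for the symmetric
bilinear form with matrix `[[0, 1], [1, 0]]` on `ℂ^{2n}`. -/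
def soC (n : ℕ) : LieSubalgebra ℂ (Mat n) := LieAlgebra.Orthogonal.typeD (Idx n) ℂ

/-- `E_k = E_{k,k} - E_{n+k,n+k}`, where `E_{j,j}` has the entry `√-1` at `(j,j)` and zeros
elsewhere. (The matrix is zero when `k ∉ {1, …, n}`.) -/
def E (n k : ℕ) : Mat n :=
  Matrix.diagonal (Sum.elim (fun p : Idx n => if (p : ℕ) = k then Complex.I else 0)
    (fun p : Idx n => if (p : ℕ) = k then -Complex.I else 0))

/-- The maximal torus `𝔱 = {∑ a_k E_k : a_k ∈ ℝ}`. -/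
def torus (n : ℕ) : Submodule ℝ (Mat n) :=
  Submodule.span ℝ ((fun k => E n k) '' Set.Icc 1 n)

/-- The functionals `L_i`, with `L_i (E_j) = √-1 δ_{ij}`: the `i`-th diagonal entry. -/
def L {n : ℕ} (i : Idx n) : Mat n →ₗ[ℂ] ℂ := Matrix.entryLinearMap ℂ ℂ (Sum.inl i) (Sum.inl i)

/-- The positive roots `L_i ± L_j`, `i < j`. -/
def posRoots (n : ℕ) : Set (Mat n →ₗ[ℂ] ℂ) :=
  {α | ∃ i j : Idx n, i < j ∧ (α = L i - L j ∨ α = L i + L j)}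

/-- The basis `H_1, …, H_n` of `𝔱` dual to the simple roots `α_i = L_i - L_{i+1}` (`i < n`) and
`α_n = L_{n-1} + L_n`, that is `α_i (H_j) = √-1 δ_{ij}`. -/
def H (n i : ℕ) : Mat n :=
  if i ≤ n - 2 then ∑ k ∈ Finset.Icc 1 i, E n k
  else if i = n - 1 then (1 / 2 : ℝ) • (∑ k ∈ Finset.Icc 1 (n - 1), E n k - E n n)
  else (1 / 2 : ℝ) • (∑ k ∈ Finset.Icc 1 (n - 1), E n k + E n n)

/-! ### The group `Spin(2n)` and its integer lattice -/

/-- Euclidean space `ℝ^{2n}`, with coordinates `(x_1, …, x_n, y_1, …, y_n)`. -/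
abbrev V (n : ℕ) : Type := Idx n ⊕ Idx n → ℝ

/-- The quadratic form `∑ x_k² + ∑ y_k²`. -/
def Q (n : ℕ) : QuadraticForm ℝ (V n) := QuadraticMap.weightedSumSquares ℝ (fun _ => (1 : ℝ))

/-- The compact group `Spin(2n)`, inside the Clifford algebra of `ℝ^{2n}`. -/
abbrev Spin (n : ℕ) : Type := spinGroup (Q n)

/-- The identification of `ℝ^{2n}` with the real points `(u, ū)`, `u = x + √-1 y`, of `ℂ^{2n}`. -/
def realPoint {n : ℕ} (v : V n) : Idx n ⊕ Idx n → ℂ :=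
  Sum.elim (fun k => ⟨v (Sum.inl k), v (Sum.inr k)⟩) (fun k => ⟨v (Sum.inl k), -v (Sum.inr k)⟩)

/-- The action on `ℝ^{2n}` of an element `X` of the compact real form
`𝔰𝔬(2n) = {X ∈ 𝔰𝔬(2n, ℂ) : Xᴴ = -X}`: such an `X` preserves the real points of `ℂ^{2n}`, and
`realPoint (act X v) = X *ᵥ realPoint v`. -/
def act {n : ℕ} (X : Mat n) (v : V n) : V n :=
  Sum.elim (fun k => ((X *ᵥ realPoint v) (Sum.inl k)).re)
    (fun k => ((X *ᵥ realPoint v) (Sum.inl k)).im)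

/-- The element of the Lie algebra of `Spin(2n)` corresponding to `X ∈ 𝔰𝔬(2n)` under the
differential of the double covering `Spin(2n) → SO(2n)`, `g ↦ (v ↦ g v g⁻¹)`. It is
`(1/4) ∑_b (X b) b`, where `b` runs through the standard basis; its commutator with
`v ∈ ℝ^{2n}` is `X v`. -/
def spinLie {n : ℕ} (X : Mat n) : CliffordAlgebra (Q n) :=
  (1 / 4 : ℝ) • ∑ b : Idx n ⊕ Idx n,
    CliffordAlgebra.ι (Q n) (act X (Pi.single b 1)) * CliffordAlgebra.ι (Q n) (Pi.single b 1)

/-- `γ` is the one-parameter subgroup `t ↦ exp (t X)` of `Spin(2n)`: the homomorphism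
`ℝ → Spin(2n)` with velocity `X ∈ 𝔰𝔬(2n)` at `t = 0`. The derivative is taken in the
finite-dimensional algebra that contains `Spin(2n)`, that is, against all linear functionals. -/
def IsOneParameterSubgroup {n : ℕ} (X : Mat n) (γ : Multiplicative ℝ →* Spin n) : Prop :=
  ∀ f : CliffordAlgebra (Q n) →ₗ[ℝ] ℝ,
    HasDerivAt (fun t : ℝ => f (γ (Multiplicative.ofAdd t) : CliffordAlgebra (Q n)))
      (f (spinLie X)) 0

/-- `exp X = g`, for the exponential map `exp : 𝔰𝔬(2n) → Spin(2n)`. -/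
def ExpEq {n : ℕ} (X : Mat n) (g : Spin n) : Prop :=
  ∃ γ : Multiplicative ℝ →* Spin n, IsOneParameterSubgroup X γ ∧ γ (Multiplicative.ofAdd 1) = g

/-- The integer lattice `(2π)⁻¹ exp⁻¹(e) ∩ 𝔱` of `Spin(2n)`. -/
def integerLattice (n : ℕ) : Set (Mat n) :=
  {ξ | ξ ∈ torus n ∧ ExpEq ((2 * Real.pi) • ξ) 1}

/-- The elements `ξ` of the integer lattice with `α(ξ) ≥ 0` for every positive root `α`. Roots are
purely imaginary on `𝔱`, and the inequality means `α(ξ) ∈ √-1 [0, ∞)`. -/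
def dominantLattice (n : ℕ) : Set (Mat n) :=
  {ξ | ξ ∈ integerLattice n ∧ ∀ α ∈ posRoots n, 0 ≤ (α ξ).im}

/-! ### The partial order and canonical elements -/

/-- `𝔤_i^ξ`: the `√-1 i`-eigenspace of `ad ξ` on `𝔤^ℂ = 𝔰𝔬(2n, ℂ)`. -/
def gr {n : ℕ} (ξ : Mat n) (i : ℤ) : Submodule ℂ (Mat n) :=
  (soC n).toSubmodule ⊓ Module.End.eigenspace (LieAlgebra.ad ℂ (Mat n) ξ) (Complex.I * i)

/-- `𝔭_i^ξ = ⨁_{j ≤ i} 𝔤_j^ξ`. -/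
def par {n : ℕ} (ξ : Mat n) (i : ℤ) : Submodule ℂ (Mat n) :=
  ⨆ j : ℤ, ⨆ _ : j ≤ i, gr ξ j

/-- The relation `ξ ≼ ξ'`: `𝔭_i^ξ ⊆ 𝔭_i^ξ'` for all `i ≥ 0`. -/
def Prec {n : ℕ} (ξ ξ' : Mat n) : Prop := ∀ i : ℤ, 0 ≤ i → par ξ i ≤ par ξ' i

/-- The cone `ℭ_I = {∑ c_i H_i : c_i ≥ 0, and c_j = 0 iff j ∉ I}`. -/
def cone (n : ℕ) (I : Finset ℕ) : Set (Mat n) :=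
  {ξ | ∃ c : ℕ → ℝ, (∀ i ∈ Finset.Icc 1 n, 0 ≤ c i ∧ (c i = 0 ↔ i ∉ I)) ∧
    ξ = ∑ i ∈ Finset.Icc 1 n, c i • H n i}

/-- `ξ` is an `I`-canonical element of `Spin(2n)`: a maximal element, for `≼`, among the dominant
elements of the integer lattice that lie in the cone `ℭ_I`. -/
def IsCanonical (n : ℕ) (I : Finset ℕ) (ξ : Mat n) : Prop :=
  ξ ∈ dominantLattice n ∩ cone n I ∧
    ∀ ξ' ∈ dominantLattice n ∩ cone n I, Prec ξ ξ' → ξ = ξ'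

/-- `ξ_I = ∑_{i ∈ I} H_i`. -/
def xi (n : ℕ) (I : Finset ℕ) : Mat n := ∑ i ∈ I, H n i

end

end SpinCanonical

/-! Write `ξ = ∑ c_i H_i = ∑ a_k E_k`. The maximal torus of `Spin(2n)` consists of products of
factors `cos θ_k + sin θ_k B_k`, where the `B_k` are the commuting bivectors `plane k`, and `exp
(2πξ)` has half-angles `θ_k = π a_k`. Such a product is `1` only if every sine vanishes, and it is
then the scalar `∏ cos (π a_k)`. So the integer lattice is given by integral `a_k` with even sum
(`torusElt_eq_one_iff`, `expEq_one_iff`).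

The simple roots take the values `c_k` on `ξ`, so integrality and the cone make `c` a vector of
natural numbers with support `I`. In terms of `c` the lattice condition says that `c_n = c_{n-1} +
2w` and that `∑_{i ≤ n-2} i c_i + (n-1) c_{n-1} + n w` is even, with `w = a_n`. Testing the
filtrations on root vectors shows that `≼` is the reverse of the coefficientwise order
(`prec_point_iff`); canonical elements are therefore the minimal feasible vectors
(`isCanonical_iff`).

The first `n - 2` coefficients enter only through the parity of `∑ i c_i`. In a minimal vector they
equal `1` on `I₀`, except that one odd index may be raised to `2` to flip the parity
(`minimal_feasible_iff`). What remains is to find the minimal pairs `(c_{n-1}, c_n)`: for odd `n`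
their difference is prescribed mod 4, for even `n` both have a prescribed parity. -/

namespace SpinCanonical

noncomputable section

/-! ### Flows in a real algebra -/

section Flow

variable {A : Type*} [Ring A] [Algebra ℝ A]

/-- `γ` solves `γ' = γ X`, the derivative being taken against all linear functionals. -/
def IsFlow (X : A) (γ : ℝ → A) : Prop :=
  ∀ (f : A →ₗ[ℝ] ℝ) (t : ℝ), HasDerivAt (fun s => f (γ s)) (f (γ t * X)) t

/-- `cos θ + sin θ B`, which is `exp (θ B)` when `B² = -1`. -/
def rot (B : A) (θ : ℝ) : A := Real.cos θ • (1 : A) + Real.sin θ • B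

@[simp] theorem rot_zero (B : A) : rot B 0 = 1 := by simp [rot]

theorem rot_add {B : A} (hB : B * B = -1) (θ φ : ℝ) : rot B (θ + φ) = rot B θ * rot B φ := by
  simp only [rot, Real.cos_add, Real.sin_add, mul_add, add_mul, smul_mul_smul_comm, one_mul,
    mul_one, hB]
  module

theorem commute_rot {X B : A} (h : Commute X B) (θ : ℝ) : Commute X (rot B θ) :=
  ((Commute.one_right X).smul_right _).add_right (h.smul_right _)

/-- The product rule, reduced to scalar functions: `γ(s) rot B (sb)` is a combination of `γ(s)` and
`γ(s) B` with coefficients `cos (sb)` and `sin (sb)`. -/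
theorem IsFlow.mul_rot {X : A} {γ : ℝ → A} (h : IsFlow X γ) {B : A} (hB : B * B = -1)
    (hX : Commute X B) (b : ℝ) : IsFlow (X + b • B) (fun t => γ t * rot B (t * b)) := by
  intro f t
  have key : ∀ s, f (γ s * rot B (s * b)) =
      Real.cos (s * b) * f (γ s) + Real.sin (s * b) * f (γ s * B) := by
    intro s
    simp [rot, mul_add]
  have h1 := h f t
  have h2 := h (f ∘ₗ LinearMap.mulRight ℝ B) t
  simp only [LinearMap.comp_apply, LinearMap.mulRight_apply] at h2
  have hl : HasDerivAt (fun s : ℝ => s * b) b t := by simpa using (hasDerivAt_id t).mul_const b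
  have h3 := (hl.cos.mul h1).add (hl.sin.mul h2)
  simp only [key]
  have e : γ t * rot B (t * b) * (X + b • B) = Real.cos (t * b) • (γ t * X)
      + (b * Real.cos (t * b)) • (γ t * B) + Real.sin (t * b) • (γ t * X * B)
      - (b * Real.sin (t * b)) • γ t := by
    have e1 : γ t * X * B = γ t * (B * X) := by rw [mul_assoc, hX.eq]
    have e2 : γ t * B * B = - γ t := by rw [mul_assoc, hB]; simp
    simp only [rot, mul_add, add_mul, mul_smul_comm, smul_mul_assoc, mul_one, e1, e2,
      ← mul_assoc]
    module
  rw [e]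
  refine h3.congr_deriv ?_
  simp only [map_add, map_sub, map_smul, smul_eq_mul]
  ring

theorem isFlow_one : IsFlow (0 : A) (fun _ => 1) := by
  intro f t
  simpa using hasDerivAt_const t (f 1)

/-- Linear functionals separate the points of a real vector space, so the scalar statement suffices
and `A` needs no topology. -/
theorem IsFlow.eq_const {γ : ℝ → A} (h : IsFlow 0 γ) (s t : ℝ) : γ s = γ t := by
  rw [← sub_eq_zero, ← Module.forall_dual_apply_eq_zero_iff ℝ]
  intro f
  rw [map_sub, sub_eq_zero]
  have h' : ∀ t, HasDerivAt (fun s => f (γ s)) 0 t := fun t => by simpa using h f t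
  exact is_const_of_deriv_eq_zero (fun t => (h' t).differentiableAt) (fun t => (h' t).deriv) s t

variable {ι : Type*}

/-- The product of the elements `exp (θ_k B_k)`, in the order of a list of indices. -/
def rotList (B : ι → A) (l : List ι) (θ : ι → ℝ) : A := (l.map fun k => rot (B k) (θ k)).prod

theorem IsFlow.mul_rotList {B : ι → A} (hB : ∀ k, B k * B k = -1)
    (hc : ∀ k l, Commute (B k) (B l)) (b : ι → ℝ) (l : List ι) :
    ∀ {X : A} {γ : ℝ → A}, IsFlow X γ → (∀ k, Commute X (B k)) →
      IsFlow (X + (l.map fun k => b k • B k).sum)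
        (fun t => γ t * rotList B l (fun k => t * b k)) := by
  induction l with
  | nil => intro X γ h _; simpa [rotList] using h
  | cons k l ih =>
    intro X γ h hX
    have := ih (h.mul_rot (hB k) (hX k) (b k))
      (fun j => (hX j).add_left ((hc k j).smul_left _))
    simpa [rotList, mul_assoc, add_assoc] using this

theorem commute_rotList {B : ι → A} {x : A} (l : List ι) (h : ∀ k ∈ l, Commute x (B k))
    (θ : ι → ℝ) : Commute x (rotList B l θ) := by
  apply Commute.list_prod_right
  intro y hy
  obtain ⟨k, hk, rfl⟩ := List.mem_map.1 hy
  exact commute_rot (h k hk) _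

theorem rotList_add {B : ι → A} (hB : ∀ k, B k * B k = -1)
    (hc : ∀ k l, Commute (B k) (B l)) (l : List ι) (θ φ : ι → ℝ) :
    rotList B l (θ + φ) = rotList B l θ * rotList B l φ := by
  induction l with
  | nil => simp [rotList]
  | cons k l ih =>
    have h : Commute (rot (B k) (φ k)) (rotList B l θ) :=
      commute_rotList l (fun j _ => (commute_rot (hc j k) _).symm) θ
    simp only [rotList, List.map_cons, List.prod_cons, Pi.add_apply] at ih h ⊢
    rw [ih, rot_add (hB k), mul_assoc, mul_assoc, ← mul_assoc _ _ (List.prod _), h.eq]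
    simp only [mul_assoc]

theorem rotList_zero (B : ι → A) (l : List ι) : rotList B l 0 = 1 := by
  simp [rotList]

theorem rotList_of_sin_eq_zero (B : ι → A) (l : List ι) (θ : ι → ℝ)
    (h : ∀ k, Real.sin (θ k) = 0) :
    rotList B l θ = algebraMap ℝ A (l.map fun k => Real.cos (θ k)).prod := by
  induction l with
  | nil => simp [rotList]
  | cons k l ih =>
    simp only [rotList, List.map_cons, List.prod_cons] at ih ⊢
    rw [ih, map_mul, rot, h, zero_smul, add_zero, Algebra.smul_def, mul_one]

/-- Moving `x` across the product reverses the single angle `θ k`; this is what isolates one angle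
of a torus element. -/
theorem mul_rotList_eq [DecidableEq ι] {B : ι → A} {x : A} {k : ι}
    (hk : x * B k = -(B k * x)) (h : ∀ l, l ≠ k → Commute x (B l)) (l : List ι) (θ : ι → ℝ) :
    x * rotList B l θ = rotList B l (Function.update θ k (-θ k)) * x := by
  induction l with
  | nil => simp [rotList]
  | cons j l ih =>
    simp only [rotList, List.map_cons, List.prod_cons] at ih ⊢
    have : x * rot (B j) (θ j) = rot (B j) (Function.update θ k (-θ k) j) * x := by
      by_cases hj : j = k
      · subst hj
        simp [rot, mul_add, add_mul, hk]
      · simpa [hj] using (commute_rot (h j hj) (θ j)).eq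
    rw [← mul_assoc, this, mul_assoc, ih, mul_assoc]

end Flow

/-! ### The maximal torus of the spin group -/

open CliffordAlgebra

variable {n : ℕ}

theorem Q_apply (v : V n) : Q n v = ∑ b, v b * v b := by
  simp [Q, QuadraticMap.weightedSumSquares_apply]

/-- The generators of the Clifford algebra given by the standard basis. -/
def gen (b : Idx n ⊕ Idx n) : CliffordAlgebra (Q n) := ι (Q n) (Pi.single b 1)

theorem Q_single (b : Idx n ⊕ Idx n) : Q n (Pi.single b 1) = 1 := by
  simp [Q_apply, Pi.single_apply]

theorem gen_mul_self (b : Idx n ⊕ Idx n) : gen b * gen b = 1 := by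
  rw [gen, ι_sq_scalar, Q_single, map_one]

theorem isOrtho_single {b c : Idx n ⊕ Idx n} (h : b ≠ c) :
    (Q n).IsOrtho (Pi.single b 1 : V n) (Pi.single c 1) := by
  rw [QuadraticMap.isOrtho_def, Q_single, Q_single, Q_apply]
  have : ∀ d, (Pi.single b 1 + Pi.single c 1 : V n) d * (Pi.single b 1 + Pi.single c 1 : V n) d =
      (if d = b then 1 else 0) + (if d = c then 1 else 0) := by
    intro d
    simp only [Pi.add_apply, Pi.single_apply]
    split_ifs with h1 h2
    · exact absurd (h1.symm.trans h2) h
    all_goals norm_num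
  simp only [this, Finset.sum_add_distrib]
  simp

theorem gen_mul_gen {b c : Idx n ⊕ Idx n} (h : b ≠ c) : gen b * gen c = -(gen c * gen b) :=
  ι_mul_ι_comm_of_isOrtho (isOrtho_single h)

/-- The generator of the rotations in the `k`-th coordinate plane. -/
def plane (k : Idx n) : CliffordAlgebra (Q n) := gen (Sum.inr k) * gen (Sum.inl k)

theorem plane_mul_self (k : Idx n) : plane k * plane k = -1 := by
  have h := gen_mul_gen (b := Sum.inl k) (c := Sum.inr k) (by simp)
  rw [plane, mul_assoc, ← mul_assoc (gen (Sum.inl k)), h]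
  simp [mul_assoc, gen_mul_self]

theorem gen_inl_mul_plane (k : Idx n) : gen (Sum.inl k) * plane k = -(plane k * gen (Sum.inl k)) := by
  have h := gen_mul_gen (b := Sum.inl k) (c := Sum.inr k) (by simp)
  rw [plane, ← mul_assoc, h, neg_mul]

theorem commute_gen_plane {b : Idx n ⊕ Idx n} {k : Idx n} (h1 : b ≠ Sum.inl k)
    (h2 : b ≠ Sum.inr k) : Commute (gen b) (plane k) := by
  rw [Commute, SemiconjBy, plane, ← mul_assoc, gen_mul_gen h2, neg_mul, mul_assoc, gen_mul_gen h1]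
  simp [mul_assoc]

theorem commute_plane (k l : Idx n) : Commute (plane k) (plane l) := by
  by_cases h : k = l
  · rw [h]
  · exact (commute_gen_plane (by simp) (by simpa using h)).mul_left
      (commute_gen_plane (by simpa using h) (by simp))

/-- The element of the maximal torus of the spin group with half-angles `θ_k`. -/
def torusElt (θ : Idx n → ℝ) : CliffordAlgebra (Q n) := rotList plane Finset.univ.toList θ

theorem torusElt_add (θ φ : Idx n → ℝ) : torusElt (θ + φ) = torusElt θ * torusElt φ :=
  rotList_add plane_mul_self commute_plane _ _ _

theorem torusElt_zero : torusElt (0 : Idx n → ℝ) = 1 := rotList_zero _ _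

theorem isUnit_ι {u : V n} (hu : Q n u = 1) :
    ι (Q n) u ∈ Submonoid.map (Units.coeHom (CliffordAlgebra (Q n)))
      (lipschitzGroup (Q n)).toSubmonoid := by
  have h : ι (Q n) u * ι (Q n) u = 1 := by rw [ι_sq_scalar, hu, map_one]
  exact ⟨⟨_, _, h, h⟩, Subgroup.subset_closure ⟨u, rfl⟩, rfl⟩

theorem ι_mul_ι_mem_spinGroup {u v : V n} (hu : Q n u = 1) (hv : Q n v = 1) :
    ι (Q n) u * ι (Q n) v ∈ spinGroup (Q n) := by
  have h1 : ι (Q n) u * ι (Q n) u = 1 := by rw [ι_sq_scalar, hu, map_one]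
  have h2 : ι (Q n) v * ι (Q n) v = 1 := by rw [ι_sq_scalar, hv, map_one]
  refine ⟨⟨mul_mem (isUnit_ι hu) (isUnit_ι hv), ?_⟩, ι_mul_ι_mem_evenOdd_zero (Q n) u v⟩
  rw [SetLike.mem_coe, Unitary.mem_iff]
  simp only [star_mul, star_ι, neg_mul, mul_neg, neg_neg]
  constructor
  · rw [mul_assoc, ← mul_assoc (ι (Q n) u), h1, one_mul, h2]
  · rw [mul_assoc, ← mul_assoc (ι (Q n) v), h2, one_mul, h1]

theorem rot_plane_mem_spinGroup (k : Idx n) (θ : ℝ) : rot (plane k) θ ∈ spinGroup (Q n) := by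
  -- A plane rotation is a product of two reflections, here in unit vectors at angle `θ`.
  have h : rot (plane k) θ = ι (Q n) (Pi.single (Sum.inr k) 1) *
      ι (Q n) (Real.cos θ • Pi.single (Sum.inr k) 1 + Real.sin θ • Pi.single (Sum.inl k) 1) := by
    have := gen_mul_self (Sum.inr k)
    simp only [gen] at this
    simp [rot, plane, gen, mul_add, this]
  rw [h]
  refine ι_mul_ι_mem_spinGroup (Q_single _) ?_
  rw [Q_apply, Fintype.sum_sum_type]
  simp [Pi.single_apply]
  nlinarith [Real.sin_sq_add_cos_sq θ]

theorem torusElt_mem_spinGroup (θ : Idx n → ℝ) : torusElt θ ∈ spinGroup (Q n) := by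
  apply Submonoid.list_prod_mem
  intro x hx
  obtain ⟨k, -, rfl⟩ := List.mem_map.1 hx
  exact rot_plane_mem_spinGroup k _

theorem torusElt_of_sin_eq_zero {θ : Idx n → ℝ} (h : ∀ k, Real.sin (θ k) = 0) :
    torusElt θ = algebraMap ℝ _ (∏ k, Real.cos (θ k)) := by
  rw [torusElt, rotList_of_sin_eq_zero _ _ _ h, Finset.prod_map_toList]

theorem algebraMap_clifford_injective :
    Function.Injective (algebraMap ℝ (CliffordAlgebra (Q n))) :=
  FaithfulSMul.algebraMap_injective ℝ _

/-- Conjugation by `gen (Sum.inl k)` flips the sign of `θ k` alone. Dividing the two torus elements,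
both equal to `1`, leaves `rot (plane k) (2 * θ k) = 1`. Adding the inverse cancels the bivector
term, so only injectivity of the scalars is needed, not linear independence of products of
bivectors. -/
theorem sin_eq_zero_of_torusElt_eq_one {θ : Idx n → ℝ} (h : torusElt θ = 1) (k : Idx n) :
    Real.sin (θ k) = 0 := by
  classical
  have flip : ∀ φ : Idx n → ℝ, torusElt φ = 1 → torusElt (Function.update φ k (-φ k)) = 1 := by
    intro φ hφ
    have h1 := mul_rotList_eq (gen_inl_mul_plane k)
      (fun l hl => commute_gen_plane (b := Sum.inl k) (k := l) (by simpa using Ne.symm hl)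
        (by simp)) Finset.univ.toList φ
    rw [← torusElt, ← torusElt, hφ, mul_one] at h1
    have h2 := congrArg (· * gen (Sum.inl k)) h1
    simp only [mul_assoc, gen_mul_self, mul_one] at h2
    exact h2.symm
  have inv : ∀ φ : Idx n → ℝ, torusElt φ = 1 → torusElt (-φ) = 1 := by
    intro φ hφ
    have := torusElt_add φ (-φ)
    rwa [add_neg_cancel, torusElt_zero, hφ, one_mul, eq_comm] at this
  have single : ∀ x : ℝ, torusElt (Pi.single k x) = rot (plane k) x := by
    intro x
    rw [torusElt, rotList, List.prod_map_eq_pow_single k]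
    · rw [@List.count_eq_one_of_mem _ instBEqOfDecidableEq _ _ _ (Finset.nodup_toList _) (by simp)]
      simp
    · intro j hj _
      simp [hj]
  have h1 : torusElt (Pi.single k (2 * θ k)) = 1 := by
    have e : Pi.single k (2 * θ k) = θ + -Function.update θ k (-θ k) := by
      ext j
      by_cases hj : j = k
      · subst hj; simp; ring
      · simp [hj]
    rw [e, torusElt_add, h, one_mul, inv _ (flip _ h)]
  have h2 := inv _ h1
  rw [← Pi.single_neg, single] at h2
  rw [single] at h1
  have h3 : algebraMap ℝ (CliffordAlgebra (Q n)) (2 * Real.cos (2 * θ k)) = algebraMap ℝ _ 2 := by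
    have : rot (plane k) (2 * θ k) + rot (plane k) (-(2 * θ k)) = 1 + 1 := by rw [h1, h2]
    simp only [rot, Real.cos_neg, Real.sin_neg] at this
    rw [Algebra.algebraMap_eq_smul_one, Algebra.algebraMap_eq_smul_one, two_smul, ← this]
    module
  have h4 := algebraMap_clifford_injective h3
  rw [Real.cos_two_mul_eq_one_sub] at h4
  nlinarith [sq_nonneg (Real.sin (θ k))]

theorem torusElt_eq_one_iff (a : Idx n → ℝ) :
    torusElt (fun k => Real.pi * a k) = 1 ↔
      ∃ m : Idx n → ℤ, (∀ k, a k = m k) ∧ Even (∑ k, m k) := by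
  have cosm : ∀ m : Idx n → ℤ, (∀ k, a k = m k) → (∀ k, Real.sin (Real.pi * a k) = 0) ∧
      ∏ k, Real.cos (Real.pi * a k) = (-1) ^ (∑ k, m k) := by
    intro m hm
    have hs : ∀ k, Real.pi * a k = m k * Real.pi := fun k => by rw [hm, mul_comm]
    constructor
    · intro k; rw [hs, Real.sin_int_mul_pi]
    · simp only [hs, Real.cos_int_mul_pi]
      induction (Finset.univ : Finset (Idx n)) using Finset.induction_on with
      | empty => simp
      | insert j s hj ih => rw [Finset.prod_insert hj, Finset.sum_insert hj, ih, zpow_add₀ (by norm_num)]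
  constructor
  · intro h
    have hs := sin_eq_zero_of_torusElt_eq_one h
    have : ∀ k, ∃ m : ℤ, a k = m := by
      intro k
      obtain ⟨m, hm⟩ := Real.sin_eq_zero_iff.1 (hs k)
      refine ⟨m, ?_⟩
      have := Real.pi_pos.ne'
      rw [mul_comm] at hm
      exact (mul_left_cancel₀ this hm).symm
    choose m hm using this
    refine ⟨m, hm, ?_⟩
    rw [torusElt_of_sin_eq_zero hs, (cosm m hm).2] at h
    have h' := algebraMap_clifford_injective (h.trans (map_one _).symm)
    by_contra hodd
    rw [Int.not_even_iff_odd] at hodd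
    rw [hodd.neg_one_zpow] at h'
    norm_num at h'
  · rintro ⟨m, hm, he⟩
    rw [torusElt_of_sin_eq_zero (cosm m hm).1, (cosm m hm).2, he.neg_one_zpow, map_one]

end

/-! ### Diagonal coordinates on the maximal torus. -/

noncomputable section

variable {n : ℕ}

/-- The element `∑ a_k E_k` of the torus. -/
def D (n : ℕ) : (ℕ → ℝ) →ₗ[ℝ] Mat n where
  toFun a := Matrix.diagonal (Sum.elim (fun k : Idx n => (a k : ℂ) * Complex.I)
    (fun k : Idx n => -((a k : ℂ) * Complex.I)))
  map_add' a b := by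
    rw [Matrix.diagonal_add]
    congr 1
    ext (k | k) <;> simp <;> ring
  map_smul' r a := by
    rw [← Matrix.diagonal_smul]
    congr 1
    ext (k | k) <;> simp <;> ring

theorem D_apply (a : ℕ → ℝ) : D n a =
    Matrix.diagonal (Sum.elim (fun k : Idx n => (a k : ℂ) * Complex.I)
      (fun k : Idx n => -((a k : ℂ) * Complex.I))) := rfl

theorem D_eq_iff {a b : ℕ → ℝ} : D n a = D n b ↔ ∀ k ∈ Finset.Icc 1 n, a k = b k := by
  rw [D_apply, D_apply, Matrix.diagonal_injective.eq_iff]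
  constructor
  · intro h k hk
    simpa using congrFun h (Sum.inl ⟨k, hk⟩)
  · intro h
    ext (k | k) <;> simp [h k k.2]

theorem E_eq (k : ℕ) : E n k = D n (Pi.single k 1) := by
  rw [D_apply, E]
  congr 1
  ext (p | p) <;> by_cases h : (p : ℕ) = k <;> simp [h]

theorem D_eq_sum (a : ℕ → ℝ) : D n a = ∑ k ∈ Finset.Icc 1 n, a k • E n k := by
  simp only [E_eq, ← map_smul, ← map_sum]
  rw [D_eq_iff]
  intro k hk
  rw [Finset.sum_apply]
  simp only [Pi.smul_apply, Pi.single_apply, smul_eq_mul, mul_ite, mul_one, mul_zero]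
  rw [Finset.sum_ite_eq, if_pos hk]

theorem mem_torus_iff {ξ : Mat n} : ξ ∈ torus n ↔ ∃ a, ξ = D n a := by
  constructor
  · intro h
    have : torus n ≤ LinearMap.range (D n) := by
      rw [torus, Submodule.span_le]
      rintro _ ⟨k, -, rfl⟩
      exact ⟨_, (E_eq k).symm⟩
    obtain ⟨a, rfl⟩ := this h
    exact ⟨a, rfl⟩
  · rintro ⟨a, rfl⟩
    rw [D_eq_sum]
    exact Submodule.sum_mem _ fun k hk => Submodule.smul_mem _ _
      (Submodule.subset_span ⟨k, by simpa using hk, rfl⟩)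

/-! ### The integer lattice -/

theorem act_D (a : ℕ → ℝ) (v : V n) : act (D n a) v =
    Sum.elim (fun k : Idx n => -(a k * v (Sum.inr k))) (fun k : Idx n => a k * v (Sum.inl k)) := by
  ext (k | k) <;> simp [act, D_apply, Matrix.mulVec_diagonal, realPoint]

/-- The two basis vectors of each plane contribute equally, turning `1/4` into `1/2`: the half-angle
of the double cover. -/
theorem spinLie_D (a : ℕ → ℝ) : spinLie (D n a) = ∑ k : Idx n, (a k / 2) • plane k := by
  have h1 : ∀ k : Idx n, act (D n a) (Pi.single (Sum.inl k) 1) =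
      a k • Pi.single (Sum.inr k) 1 := by
    intro k
    rw [act_D]
    ext (j | j)
    · simp
    · by_cases h : j = k <;> simp [Pi.single_apply, h]
  have h2 : ∀ k : Idx n, act (D n a) (Pi.single (Sum.inr k) 1) =
      -a k • Pi.single (Sum.inl k) 1 := by
    intro k
    rw [act_D]
    ext (j | j)
    · by_cases h : j = k <;> simp [Pi.single_apply, h]
    · simp
  rw [spinLie, Fintype.sum_sum_type, ← Finset.sum_add_distrib, Finset.smul_sum]
  refine Finset.sum_congr rfl fun k _ => ?_
  rw [h1, h2, map_smul, map_smul, smul_mul_assoc, smul_mul_assoc]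
  change (1 / 4 : ℝ) • (a k • plane k + -a k • (gen (Sum.inl k) * gen (Sum.inr k))) = _
  rw [gen_mul_gen (by simp), ← plane]
  module

/-- The velocity at `0` determines the velocity at `t`: precompose the functional with left
multiplication by `γ(t)`. -/
theorem isFlow_of_isOneParameterSubgroup {X : Mat n} {γ : Multiplicative ℝ →* Spin n}
    (h : IsOneParameterSubgroup X γ) : IsFlow (spinLie X)
      (fun t => (γ (Multiplicative.ofAdd t) : CliffordAlgebra (Q n))) := by
  intro f t
  have h0 := h (f ∘ₗ LinearMap.mulLeft ℝ (γ (Multiplicative.ofAdd t) : CliffordAlgebra (Q n)))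
  have h1 : HasDerivAt (fun s : ℝ => s - t) 1 t := (hasDerivAt_id t).sub_const t
  rw [← sub_self t] at h0
  have h2 := HasDerivAt.comp (h := fun s : ℝ => s - t) t h0 h1
  rw [mul_one] at h2
  refine h2.congr_of_eventuallyEq (Filter.Eventually.of_forall fun s => ?_)
  have : Multiplicative.ofAdd s = Multiplicative.ofAdd t * Multiplicative.ofAdd (s - t) := by
    rw [← ofAdd_add]; congr 1; ring
  have e := congrArg (fun x => f (γ x)) this
  rw [map_mul] at e
  exact e

theorem isFlow_mul_torusElt (b : Idx n → ℝ) {X : CliffordAlgebra (Q n)}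
    {γ : ℝ → CliffordAlgebra (Q n)} (h : IsFlow X γ) (hX : ∀ k, Commute X (plane k)) :
    IsFlow (X + ∑ k, b k • plane k) (fun t => γ t * torusElt (fun k => t * b k)) := by
  have := h.mul_rotList plane_mul_self commute_plane b Finset.univ.toList hX
  rwa [Finset.sum_map_toList] at this

/-- The one-parameter subgroups of the maximal torus of the spin group. -/
def torusHom (b : Idx n → ℝ) : Multiplicative ℝ →* Spin n where
  toFun t := ⟨torusElt (fun k => t.toAdd * b k), torusElt_mem_spinGroup _⟩
  map_one' := by
    ext
    simp only [toAdd_one, zero_mul]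
    exact torusElt_zero
  map_mul' s t := by
    ext
    simp only [toAdd_mul, add_mul, Submonoid.coe_mul]
    exact torusElt_add _ _

theorem expEq_one_iff (a : ℕ → ℝ) :
    ExpEq ((2 * Real.pi) • D n a) 1 ↔ torusElt (fun k : Idx n => Real.pi * a k) = 1 := by
  set b : Idx n → ℝ := fun k => Real.pi * a k with hb
  have hX : spinLie ((2 * Real.pi) • D n a) = ∑ k, b k • plane k := by
    rw [← map_smul, spinLie_D]
    refine Finset.sum_congr rfl fun k _ => ?_
    rw [hb, Pi.smul_apply, smul_eq_mul]
    congr 1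
    ring
  constructor
  · rintro ⟨γ, hγ, h1⟩
    have hf := isFlow_of_isOneParameterSubgroup hγ
    have hc : ∀ k, Commute (spinLie ((2 * Real.pi) • D n a)) (plane k) := by
      intro k
      rw [hX]
      exact Commute.sum_left _ _ _ fun j _ => (commute_plane j k).smul_left _
    -- Uniqueness of the one-parameter subgroup: multiplied by the inverse torus flow, `γ` has zero
    -- velocity and is constant.
    have h2 := isFlow_mul_torusElt (fun k => -b k) hf hc
    rw [hX, ← Finset.sum_add_distrib] at h2
    simp only [neg_smul, add_neg_cancel, Finset.sum_const_zero] at h2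
    have h3 := h2.eq_const 1 0
    simp only [h1, one_mul, zero_mul, ofAdd_zero, map_one, OneMemClass.coe_one] at h3
    have h4 : torusElt (fun _ : Idx n => (0 : ℝ)) = 1 := torusElt_zero
    have h5 := torusElt_add b (fun k => -b k)
    have h6 : b + (fun k => -b k) = 0 := by ext; simp
    rw [h3, h4, h6, torusElt_zero, mul_one] at h5
    exact h5.symm
  · intro h
    refine ⟨torusHom b, ?_, ?_⟩
    · intro f
      have h1 := isFlow_mul_torusElt b isFlow_one (fun k => Commute.zero_left _) f 0
      have h4 : torusElt (fun _ : Idx n => (0 : ℝ)) = 1 := torusElt_zero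
      simp only [one_mul, zero_mul, zero_add, h4] at h1
      rw [hX]
      exact h1
    · ext
      simpa [torusHom] using h

theorem D_mem_integerLattice_iff (a : ℕ → ℝ) : D n a ∈ integerLattice n ↔
    ∃ m : ℕ → ℤ, (∀ k ∈ Finset.Icc 1 n, a k = m k) ∧ Even (∑ k ∈ Finset.Icc 1 n, m k) := by
  rw [integerLattice, Set.mem_ofPred_eq, and_iff_right (mem_torus_iff.2 ⟨a, rfl⟩), expEq_one_iff,
    torusElt_eq_one_iff (fun k : Idx n => a k)]
  constructor
  · rintro ⟨m, hm, he⟩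
    refine ⟨fun k => if h : k ∈ Finset.Icc 1 n then m ⟨k, h⟩ else 0, ?_, ?_⟩
    · intro k hk
      simp only [hk, dif_pos]
      exact hm ⟨k, hk⟩
    · rw [← Finset.sum_coe_sort]
      convert he using 2
      simp
  · rintro ⟨m, hm, he⟩
    refine ⟨fun k => m k, fun k => hm k k.2, ?_⟩
    rwa [← Finset.sum_coe_sort] at he

/-! ### Coordinates with respect to the dual basis -/

/-- The coordinates of `H_i` with respect to the `E_k`. -/
def hCoord (n i k : ℕ) : ℝ :=
  if i ≤ n - 2 then (if k ≤ i then 1 else 0)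
  else if i = n - 1 then (if k ≤ n - 1 then 1 / 2 else -1 / 2) else 1 / 2

theorem H_eq (hn : 2 ≤ n) (i : ℕ) : H n i = D n (hCoord n i) := by
  have hs : ∀ (m k : ℕ), 1 ≤ k → (∑ l ∈ Finset.Icc 1 m, (Pi.single l 1 : ℕ → ℝ)) k =
      if k ≤ m then 1 else 0 := by
    intro m k hk
    rw [Finset.sum_apply]
    simp [Pi.single_apply, hk]
  unfold H
  simp only [E_eq, ← map_sum, ← map_sub, ← map_add, ← map_smul]
  split_ifs with h1 h2
  all_goals
    rw [D_eq_iff]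
    intro k hk
    have hk' := Finset.mem_Icc.1 hk
    simp only [Pi.smul_apply, Pi.sub_apply, Pi.add_apply, hs _ _ hk'.1, hCoord, h1, if_true, if_false,
      Pi.single_apply, smul_eq_mul]
  · rw [if_pos h2]
    by_cases h : k = n
    · rw [if_neg (by omega), if_pos h, if_neg (by omega)]; norm_num
    · rw [if_pos (by omega), if_neg h, if_pos (by omega)]; norm_num
  · rw [if_neg h2]
    by_cases h : k = n
    · rw [if_neg (by omega), if_pos h]; norm_num
    · rw [if_pos (by omega), if_neg h]; norm_num

/-- The coordinates of `∑ c_i H_i` with respect to the `E_k`. -/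
def coord (n : ℕ) (c : ℕ → ℝ) (k : ℕ) : ℝ := ∑ i ∈ Finset.Icc 1 n, c i * hCoord n i k

theorem sum_smul_H (hn : 2 ≤ n) (c : ℕ → ℝ) :
    ∑ i ∈ Finset.Icc 1 n, c i • H n i = D n (coord n c) := by
  simp only [H_eq hn, ← map_smul, ← map_sum]
  congr 1
  ext k
  simp [coord]

theorem coord_sub (c : ℕ → ℝ) {k : ℕ} (hk : k ∈ Finset.Icc 1 (n - 1)) :
    coord n c k - coord n c (k + 1) = c k := by
  rw [Finset.mem_Icc] at hk
  rw [coord, coord, ← Finset.sum_sub_distrib, Finset.sum_eq_single_of_mem k]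
  · simp only [← mul_sub, hCoord]
    split_ifs <;> first | omega | norm_num
  · simp; omega
  · intro i hi hik
    rw [Finset.mem_Icc] at hi
    simp only [← mul_sub, hCoord]
    split_ifs <;> first | omega | norm_num

theorem coord_add (hn : 2 ≤ n) (c : ℕ → ℝ) : coord n c (n - 1) + coord n c n = c n := by
  rw [coord, coord, ← Finset.sum_add_distrib, Finset.sum_eq_single_of_mem n]
  · simp only [← mul_add, hCoord]
    split_ifs <;> first | omega | norm_num
  · simp; omega
  · intro i hi hik
    rw [Finset.mem_Icc] at hi
    simp only [← mul_add, hCoord]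
    split_ifs <;> first | omega | norm_num

theorem sum_coord (hn : 2 ≤ n) (c : ℕ → ℝ) : ∑ k ∈ Finset.Icc 1 n, coord n c k =
    ∑ i ∈ Finset.Icc 1 (n - 2), i * c i + (n - 1) * c (n - 1) + n * coord n c n := by
  obtain ⟨m, rfl⟩ := Nat.exists_eq_add_of_le' hn
  -- Abel summation, which expresses the sum through the simple-root values `a_k - a_{k+1}`.
  have habel : ∀ (a : ℕ → ℝ) (m : ℕ), ∑ k ∈ Finset.Icc 1 m, a k =
      ∑ k ∈ Finset.Icc 1 m, k * (a k - a (k + 1)) + m * a (m + 1) := by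
    intro a m
    induction m with
    | zero => simp
    | succ m ih =>
      rw [Finset.sum_Icc_succ_top (by omega), Finset.sum_Icc_succ_top (by omega), ih]
      push_cast
      ring
  have h1 := coord_sub (n := m + 2) c (k := m + 1) (by simp)
  rw [Finset.sum_Icc_succ_top (by omega), Finset.sum_Icc_succ_top (by omega), habel]
  have h2 : ∀ k ∈ Finset.Icc 1 m, (k : ℝ) * (coord (m + 2) c k - coord (m + 2) c (k + 1)) =
      k * c k := by
    intro k hk
    rw [Finset.mem_Icc] at hk
    rw [coord_sub c (by simp; omega)]
  rw [Finset.sum_congr rfl h2]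
  simp only [Nat.add_sub_cancel, show m + 2 - 1 = m + 1 from rfl, ← h1]
  push_cast
  ring

/-- If the simple roots are nonnegative then so are all positive roots. -/
theorem posRoots_nonneg {a : ℕ → ℝ} (h1 : ∀ k ∈ Finset.Icc 1 (n - 1), a (k + 1) ≤ a k)
    (h2 : 0 ≤ a (n - 1) + a n) {i j : ℕ} (hi : 1 ≤ i) (hij : i < j) (hj : j ≤ n) :
    a j ≤ a i ∧ 0 ≤ a i + a j := by
  have mono : ∀ i j, 1 ≤ i → i ≤ j → j ≤ n → a j ≤ a i := by
    intro i j hi hij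
    induction j, hij using Nat.le_induction with
    | base => intro _; rfl
    | succ j hij ih =>
      intro hj
      exact (h1 j (by simp; omega)).trans (ih (by omega))
  refine ⟨mono i j hi hij.le hj, ?_⟩
  have e1 := mono i (n - 1) hi (by omega) (by omega)
  have e2 := mono j n (by omega) hj le_rfl
  linarith

/-- The parity conditions for `∑ c_i H_i` to lie in the integer lattice of the spin group. -/
def Admissible (n : ℕ) (c : ℕ → ℕ) : Prop :=
  ∃ w : ℤ, (c n : ℤ) = c (n - 1) + 2 * w ∧
    Even (∑ i ∈ Finset.Icc 1 (n - 2), (i : ℤ) * c i + (n - 1) * c (n - 1) + n * w)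

/-- The point `∑ c_i H_i`. -/
def point (n : ℕ) (c : ℕ → ℕ) : Mat n := D n (coord n fun i => (c i : ℝ))

theorem coord_last (hn : 2 ≤ n) (c : ℕ → ℝ) : c n = c (n - 1) + 2 * coord n c n := by
  have h1 := coord_add hn c
  have h2 := coord_sub (n := n) c (k := n - 1) (by simp; omega)
  rw [Nat.sub_add_cancel (by omega)] at h2
  linarith

/-- The last coordinate is `w`, and each earlier one is obtained from its successor by adding `c k`.
-/
theorem exists_int_coord (hn : 2 ≤ n) {c : ℕ → ℕ} {w : ℤ} (hw : (c n : ℤ) = c (n - 1) + 2 * w) :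
    ∃ m : ℕ → ℤ, ∀ k ∈ Finset.Icc 1 n, coord n (fun i => (c i : ℝ)) k = m k := by
  have hl := coord_last hn (fun i => (c i : ℝ))
  have hw' : (c n : ℝ) = c (n - 1) + 2 * w := by exact_mod_cast hw
  have key : ∀ d k, 1 ≤ k → k + d = n → ∃ m : ℤ, coord n (fun i => (c i : ℝ)) k = m := by
    intro d
    induction d with
    | zero =>
      rintro k hk rfl
      exact ⟨w, by simp only [add_zero] at *; linarith⟩
    | succ d ih =>
      intro k hk hkd
      obtain ⟨m, hm⟩ := ih (k + 1) (by omega) (by omega)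
      have := coord_sub (n := n) (fun i => (c i : ℝ)) (k := k) (by simp; omega)
      exact ⟨m + c k, by push_cast; linarith⟩
  have : ∀ k, ∃ m : ℤ, k ∈ Finset.Icc 1 n → coord n (fun i => (c i : ℝ)) k = m := by
    intro k
    by_cases hk : k ∈ Finset.Icc 1 n
    · have hk' := Finset.mem_Icc.1 hk
      obtain ⟨m, hm⟩ := key (n - k) k hk'.1 (by omega)
      exact ⟨m, fun _ => hm⟩
    · exact ⟨0, fun h => absurd h hk⟩
  choose m hm using this
  exact ⟨m, hm⟩

/-- The `w` of `Admissible` is the last coordinate, and the number required to be even is the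
coordinate sum of `sum_coord`. -/
theorem point_mem_integerLattice_iff (hn : 2 ≤ n) (c : ℕ → ℕ) :
    point n c ∈ integerLattice n ↔ Admissible n c := by
  have hl := coord_last hn (fun i => (c i : ℝ))
  have hs := sum_coord hn (fun i => (c i : ℝ))
  have hnn : n ∈ Finset.Icc 1 n := by simp; omega
  have tr : ∀ m : ℕ → ℤ, (∀ k ∈ Finset.Icc 1 n, coord n (fun i => (c i : ℝ)) k = m k) →
      (c n : ℤ) = c (n - 1) + 2 * m n ∧ ∑ k ∈ Finset.Icc 1 n, m k =
        ∑ i ∈ Finset.Icc 1 (n - 2), (i : ℤ) * c i + (n - 1) * c (n - 1) + n * m n := by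
    intro m hm
    rw [hm n hnn] at hl
    rw [hm n hnn, Finset.sum_congr rfl hm] at hs
    exact ⟨by exact_mod_cast hl, by exact_mod_cast hs⟩
  rw [point, D_mem_integerLattice_iff]
  constructor
  · rintro ⟨m, hm, he⟩
    exact ⟨m n, (tr m hm).1, (tr m hm).2 ▸ he⟩
  · rintro ⟨w, hw, he⟩
    obtain ⟨m, hm⟩ := exists_int_coord hn hw
    obtain ⟨h1, h2⟩ := tr m hm
    have : w = m n := by omega
    exact ⟨m, hm, by rwa [h2, ← this]⟩

/-- The coefficient vectors of the dominant lattice points in the cone `ℭ_I`. -/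
def Feasible (n : ℕ) (I : Finset ℕ) (c : ℕ → ℕ) : Prop :=
  (∀ i, c i ≠ 0 ↔ i ∈ I) ∧ Admissible n c

theorem L_D_im (a : ℕ → ℝ) (i : Idx n) : (L i (D n a)).im = a i := by
  simp [L, D_apply]

theorem nonneg_posRoots_iff {a : ℕ → ℝ} (hn : 2 ≤ n) : (∀ α ∈ posRoots n, 0 ≤ (α (D n a)).im) ↔
    (∀ k ∈ Finset.Icc 1 (n - 1), a (k + 1) ≤ a k) ∧ 0 ≤ a (n - 1) + a n := by
  constructor
  · intro h
    constructor
    · intro k hk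
      rw [Finset.mem_Icc] at hk
      have := h _ ⟨⟨k, by simp; omega⟩, ⟨k + 1, by simp; omega⟩, by simp, Or.inl rfl⟩
      simpa [L_D_im] using this
    · have := h _ ⟨⟨n - 1, by simp; omega⟩, ⟨n, by simp; omega⟩, by
        rw [Subtype.mk_lt_mk]; omega, Or.inr rfl⟩
      simpa [L_D_im] using this
  · rintro ⟨h1, h2⟩ α ⟨i, j, hij, rfl | rfl⟩
    all_goals
      have hi := Finset.mem_Icc.1 i.2
      have hj := Finset.mem_Icc.1 j.2
      have := posRoots_nonneg h1 h2 hi.1 hij hj.2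
      simp only [LinearMap.sub_apply, LinearMap.add_apply, Complex.sub_im, Complex.add_im, L_D_im]
      linarith

theorem mem_dominantLattice_inter_cone_iff (hn : 2 ≤ n) {I : Finset ℕ}
    (hI : I ⊆ Finset.Icc 1 n) {ξ : Mat n} :
    ξ ∈ dominantLattice n ∩ cone n I ↔ ∃ c, Feasible n I c ∧ ξ = point n c := by
  constructor
  · rintro ⟨⟨hl, -⟩, c, hc, rfl⟩
    rw [sum_smul_H hn] at hl ⊢
    -- Each coefficient is a difference of two integral coordinates, or the sum of the last two.
    have hint : ∀ k ∈ Finset.Icc 1 n, ∃ m : ℤ, c k = m := by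
      obtain ⟨m, hm, -⟩ := (D_mem_integerLattice_iff _).1 hl
      intro k hk
      have hk' := Finset.mem_Icc.1 hk
      rcases eq_or_lt_of_le hk'.2 with rfl | hlt
      · refine ⟨m (k - 1) + m k, ?_⟩
        rw [← coord_add hn c, hm _ hk, hm (k - 1) (by simp; omega)]
        push_cast; rfl
      · refine ⟨m k - m (k + 1), ?_⟩
        rw [← coord_sub (n := n) c (by simp; omega), hm _ hk, hm (k + 1) (by simp; omega)]
        push_cast; rfl
    -- `Feasible` constrains all of `ℕ`, so the coefficients outside `{1, …, n}` must be set to `0`.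
    have hnat : ∀ k, ∃ m : ℕ, (k ∈ Finset.Icc 1 n → c k = m) ∧ (k ∉ Finset.Icc 1 n → m = 0) := by
      intro k
      by_cases hk : k ∈ Finset.Icc 1 n
      · obtain ⟨m, hm⟩ := hint k hk
        have h0 := (hc k hk).1
        rw [hm] at h0
        lift m to ℕ using by exact_mod_cast h0
        exact ⟨m, fun _ => by simpa using hm, fun h => absurd hk h⟩
      · exact ⟨0, fun h => absurd h hk, fun _ => rfl⟩
    choose m hm hm0 using hnat
    have hcoord : D n (coord n c) = point n m := by
      rw [point, ← sum_smul_H hn, ← sum_smul_H hn]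
      exact Finset.sum_congr rfl fun k hk => by rw [hm k hk]
    refine ⟨m, ⟨?_, ?_⟩, hcoord⟩
    · intro i
      by_cases hi : i ∈ Finset.Icc 1 n
      · have := (hc i hi).2
        rw [hm i hi, Nat.cast_eq_zero] at this
        rw [Ne, this, not_not]
      · exact ⟨fun h => absurd (hm0 i hi) h, fun h => absurd (hI h) hi⟩
    · rwa [← point_mem_integerLattice_iff hn, ← hcoord]
  · rintro ⟨c, ⟨hc, ha⟩, rfl⟩
    refine ⟨⟨(point_mem_integerLattice_iff hn c).2 ha, ?_⟩, fun i => c i, ?_, ?_⟩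
    · rw [point, nonneg_posRoots_iff hn]
      constructor
      · intro k hk
        have := coord_sub (fun i => (c i : ℝ)) hk
        have : (0 : ℝ) ≤ c k := Nat.cast_nonneg _
        linarith
      · rw [coord_add hn]
        exact Nat.cast_nonneg _
    · intro i _
      refine ⟨Nat.cast_nonneg _, ?_⟩
      rw [Nat.cast_eq_zero, ← hc, not_not]
    · rw [sum_smul_H hn, point]

theorem eq_of_point_eq (hn : 2 ≤ n) {I : Finset ℕ} (hI : I ⊆ Finset.Icc 1 n) {c d : ℕ → ℕ}
    (hc : Feasible n I c) (hd : Feasible n I d) (h : point n c = point n d) : c = d := by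
  rw [point, point, D_eq_iff] at h
  ext k
  by_cases hk : k ∈ I
  · have hk' := Finset.mem_Icc.1 (hI hk)
    have : (c k : ℝ) = d k := by
      rcases eq_or_lt_of_le hk'.2 with rfl | hlt
      · rw [← coord_add hn (fun i => (c i : ℝ)), ← coord_add hn (fun i => (d i : ℝ)),
          h _ (hI hk), h (k - 1) (by simp; omega)]
      · rw [← coord_sub (n := n) (fun i => (c i : ℝ)) (k := k) (by simp; omega),
          ← coord_sub (n := n) (fun i => (d i : ℝ)) (k := k) (by simp; omega),
          h _ (hI hk), h (k + 1) (by simp; omega)]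
    exact_mod_cast this
  · have h1 := hc.1 k
    have h2 := hd.1 k
    simp only [hk, iff_false, not_not] at h1 h2
    rw [h1, h2]

end

noncomputable section

attribute [local instance] LieRing.ofAssociativeRing

variable {n : ℕ}

/-! ### The partial order -/

/-- The weights of `∑ a_k E_k` on `ℂ^{2n}`, divided by `√-1`. -/
def weight (a : ℕ → ℝ) : Idx n ⊕ Idx n → ℝ := Sum.elim (fun k => a k) (fun k => -a k)

theorem weight_swap (a : ℕ → ℝ) (p : Idx n ⊕ Idx n) : weight a p.swap = -weight a p := by
  rcases p with p | p <;> simp [weight]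

theorem D_eq_diagonal (a : ℕ → ℝ) :
    D n a = Matrix.diagonal fun p => (weight a p : ℂ) * Complex.I := by
  rw [D_apply]
  congr 1
  ext (k | k) <;> simp [weight]

theorem mem_soC_iff {X : Mat n} : X ∈ soC n ↔ ∀ p q, X q.swap p = -X p.swap q := by
  rw [soC, LieAlgebra.Orthogonal.typeD, mem_skewAdjointMatricesLieSubalgebra,
    mem_skewAdjointMatricesSubmodule, Matrix.IsSkewAdjoint, Matrix.IsAdjointPair,
    ← Matrix.ext_iff]
  have hJ : ∀ p q, LieAlgebra.Orthogonal.JD (Idx n) ℂ p q = if p = q.swap then 1 else 0 := by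
    rintro (p | p) (q | q) <;> simp [LieAlgebra.Orthogonal.JD, Matrix.one_apply]
  have hs : ∀ p q : Idx n ⊕ Idx n, p = q.swap ↔ q = p.swap := by
    rintro (p | p) (q | q) <;> simp [eq_comm]
  refine forall₂_congr fun p q => ?_
  rw [Matrix.mul_apply, Matrix.mul_apply]
  simp only [hJ, Matrix.transpose_apply, mul_ite, mul_one, mul_zero, ite_mul, one_mul, zero_mul,
    Finset.sum_ite_eq', Finset.mem_univ, if_true, Matrix.neg_apply, hs p]

theorem mem_gr_iff (a : ℕ → ℝ) (j : ℤ) (X : Mat n) : X ∈ gr (D n a) j ↔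
    X ∈ soC n ∧ ∀ p q, X p q ≠ 0 → weight a p - weight a q = j := by
  rw [gr, Submodule.mem_inf, LieSubalgebra.mem_toSubmodule, Module.End.mem_eigenspace_iff,
    LieAlgebra.ad_apply, LieRing.of_associative_ring_bracket, ← Matrix.ext_iff]
  refine and_congr_right fun _ => forall₂_congr fun p q => ?_
  rw [D_eq_diagonal, Matrix.sub_apply, Matrix.diagonal_mul, Matrix.mul_diagonal, Matrix.smul_apply,
    smul_eq_mul]
  have e : (weight a p : ℂ) * Complex.I * X p q - X p q * (weight a q * Complex.I) =
      Complex.I * j * X p q ↔ Complex.I * X p q * ((weight a p - weight a q : ℝ) - (j : ℝ) : ℂ) = 0 := by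
    push_cast
    rw [← sub_eq_zero]
    constructor <;> intro h <;> linear_combination h
  rw [e, mul_eq_zero, mul_eq_zero, ← Complex.ofReal_sub, Complex.ofReal_eq_zero, sub_eq_zero]
  simp only [Complex.I_ne_zero, false_or]
  tauto

theorem le_of_mem_par {a : ℕ → ℝ} {i : ℤ} {X : Mat n} (h : X ∈ par (D n a) i) :
    X ∈ soC n ∧ ∀ p q, X p q ≠ 0 → weight a p - weight a q ≤ i := by
  let S : Submodule ℂ (Mat n) :=
    { carrier := {X | X ∈ soC n ∧ ∀ p q, X p q ≠ 0 → weight a p - weight a q ≤ i}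
      zero_mem' := ⟨(soC n).zero_mem, fun p q h => absurd rfl h⟩
      add_mem' := by
        rintro X Y ⟨hX, hX'⟩ ⟨hY, hY'⟩
        refine ⟨(soC n).add_mem hX hY, fun p q h => ?_⟩
        by_cases hx : X p q = 0
        · exact hY' p q fun hy => h (by simp [hx, hy])
        · exact hX' p q hx
      smul_mem' := by
        rintro r X ⟨hX, hX'⟩
        exact ⟨(soC n).smul_mem r hX, fun p q h => hX' p q fun hx => h (by simp [hx])⟩ }
  have hle : par (D n a) i ≤ S := by
    refine iSup₂_le fun j hj X hX => ?_
    obtain ⟨h1, h2⟩ := (mem_gr_iff a j X).1 hX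
    exact ⟨h1, fun p q h => (h2 p q h).trans_le (by exact_mod_cast hj)⟩
  exact hle h

/-- Converse of `le_of_mem_par`. Integrality of the weights is needed because `par` sums only
integer eigenspaces. The graded pieces `Y j` of `X` remain skew, since weights change sign under the
swap. -/
theorem mem_par_of_le {a : ℕ → ℝ} {m : ℕ → ℤ} (hm : ∀ k ∈ Finset.Icc 1 n, a k = m k) {i : ℤ}
    {X : Mat n} (hX : X ∈ soC n) (h : ∀ p q, X p q ≠ 0 → weight a p - weight a q ≤ i) :
    X ∈ par (D n a) i := by
  have hint : ∀ p : Idx n ⊕ Idx n, ∃ z : ℤ, weight a p = z := by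
    rintro (k | k)
    · exact ⟨m k, hm k k.2⟩
    · exact ⟨-m k, by simp [weight, hm k k.2]⟩
  choose z hz using hint
  set s : Finset ℤ := Finset.univ.image fun pq : (Idx n ⊕ Idx n) × (Idx n ⊕ Idx n) => z pq.1 - z pq.2
  let Y : ℤ → Mat n := fun j => Matrix.of fun p q => if z p - z q = j then X p q else 0
  have hsum : X = ∑ j ∈ s, Y j := by
    ext p q
    rw [Matrix.sum_apply]
    simp only [Y, Matrix.of_apply]
    rw [Finset.sum_ite_eq, if_pos]
    exact Finset.mem_image_of_mem (fun pq : (Idx n ⊕ Idx n) × (Idx n ⊕ Idx n) => z pq.1 - z pq.2)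
      (Finset.mem_univ (p, q))
  have hzs : ∀ p : Idx n ⊕ Idx n, z p.swap = -z p := by
    intro p
    have := weight_swap a p
    rw [hz, hz] at this
    exact_mod_cast this
  rw [hsum]
  refine Submodule.sum_mem _ fun j _ => ?_
  have hgr : Y j ∈ gr (D n a) j := by
    rw [mem_gr_iff]
    constructor
    · rw [mem_soC_iff] at hX ⊢
      intro p q
      simp only [Y, Matrix.of_apply, hzs, hX p q]
      rw [show -z q - z p = -z p - z q by ring]
      split_ifs <;> simp
    · intro p q hpq
      simp only [Y, Matrix.of_apply, ne_eq, ite_eq_right_iff, Classical.not_imp] at hpq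
      rw [hz, hz]
      exact_mod_cast hpq.1
  by_cases hj : j ≤ i
  · exact Submodule.mem_iSup_of_mem j (Submodule.mem_iSup_of_mem hj hgr)
  · have : Y j = 0 := by
      ext p q
      simp only [Y, Matrix.of_apply, Matrix.zero_apply, ite_eq_right_iff]
      intro hpq
      by_contra hx
      have := h p q hx
      rw [hz, hz] at this
      have h' : z p - z q ≤ i := by exact_mod_cast this
      omega
    rw [this]
    exact Submodule.zero_mem _

/-- The matrix with entries `1` at `(p, q)` and `-1` at `(q', p')`, where the prime exchanges the
two copies of `{1, …, n}`. -/
def rootVector (p q : Idx n ⊕ Idx n) : Mat n :=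
  Matrix.single p q 1 - Matrix.single q.swap p.swap 1

theorem rootVector_mem_soC (p q : Idx n ⊕ Idx n) : rootVector p q ∈ soC n := by
  rw [mem_soC_iff]
  intro r s
  simp only [rootVector, Matrix.sub_apply, Matrix.single_apply]
  have hs : ∀ p q : Idx n ⊕ Idx n, p = q.swap ↔ p.swap = q := by
    rintro (p | p) (q | q) <;> simp
  simp only [hs, Sum.swap_swap, neg_sub]
  congr 2 <;> simp only [and_comm]

/-- Test the inclusion on `rootVector p q`, which would vanish if `p = q.swap`. -/
theorem weight_le_of_prec {a a' : ℕ → ℝ} (h : Prec (D n a) (D n a')) {p q : Idx n ⊕ Idx n}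
    (hpq : p ≠ q.swap) {i : ℤ} (hi : 0 ≤ i) (hai : weight a p - weight a q = i) :
    weight a' p - weight a' q ≤ i := by
  have h1 : rootVector p q ∈ gr (D n a) i := by
    rw [mem_gr_iff]
    refine ⟨rootVector_mem_soC p q, fun r s hrs => ?_⟩
    simp only [rootVector, Matrix.sub_apply, Matrix.single_apply] at hrs
    by_cases h1 : p = r ∧ q = s
    · rw [← h1.1, ← h1.2, hai]
    · by_cases h2 : q.swap = r ∧ p.swap = s
      · rw [← h2.1, ← h2.2, weight_swap, weight_swap, ← hai]
        ring
      · simp [h1, h2] at hrs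
  have h2 : rootVector p q ∈ par (D n a) i :=
    Submodule.mem_iSup_of_mem i (Submodule.mem_iSup_of_mem le_rfl h1)
  refine (le_of_mem_par (h i hi h2)).2 p q ?_
  simp [rootVector, hpq.symm]

/-- Positive roots do not grow from `a` to `a'`; negative roots are nonpositive on `a'`, hence at
most `i` because `0 ≤ i`. -/
theorem prec_of_roots {a a' : ℕ → ℝ} {m' : ℕ → ℤ} (hm' : ∀ k ∈ Finset.Icc 1 n, a' k = m' k)
    (h' : ∀ i j, 1 ≤ i → i < j → j ≤ n → a' j ≤ a' i ∧ 0 ≤ a' i + a' j)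
    (h : ∀ i j, 1 ≤ i → i < j → j ≤ n → a' i - a' j ≤ a i - a j ∧ a' i + a' j ≤ a i + a j) :
    Prec (D n a) (D n a') := by
  intro i hi X hX
  obtain ⟨h1, h2⟩ := le_of_mem_par hX
  refine mem_par_of_le hm' h1 fun p q hpq => ?_
  have h3 := h2 p q hpq
  have hi' : (0 : ℝ) ≤ i := by exact_mod_cast hi
  -- Skewness kills the entries at `(p, p.swap)`: `±2 L_k` are not roots and need no bound.
  have diag : q = p.swap → False := by
    rintro rfl
    rw [mem_soC_iff] at h1
    have := h1 p.swap p.swap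
    rw [Sum.swap_swap] at this
    exact hpq (by linear_combination this / 2)
  rcases p with k | k <;> rcases q with l | l <;>
    have hk := Finset.mem_Icc.1 k.2 <;> have hl := Finset.mem_Icc.1 l.2 <;>
    simp only [weight, Sum.elim_inl, Sum.elim_inr, Sum.swap_inl, Sum.swap_inr, Sum.inl.injEq,
      Sum.inr.injEq] at h3 diag ⊢ <;>
    rcases lt_trichotomy (k : ℕ) l with hlt | heq | hgt
  all_goals first
    | (have e1 := h _ _ hk.1 hlt hl.2
       have e2 := h' _ _ hk.1 hlt hl.2
       linarith)
    | (have e1 := h _ _ hl.1 hgt hk.2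
       have e2 := h' _ _ hl.1 hgt hk.2
       linarith)
    | (rw [heq]; linarith)
    | exact (diag (Subtype.ext heq.symm)).elim

/-- Forwards, the simple root vectors have degrees `c k` and `d k`. Backwards, `c - d` is
nonnegative on simple roots, hence on all positive roots. -/
theorem prec_point_iff (hn : 2 ≤ n) {I : Finset ℕ} (hI : I ⊆ Finset.Icc 1 n) {c d : ℕ → ℕ}
    (hc : Feasible n I c) (hd : Feasible n I d) : Prec (point n c) (point n d) ↔ d ≤ c := by
  constructor
  · intro h k
    by_cases hk : k ∈ I
    · have hk' := Finset.mem_Icc.1 (hI hk)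
      rw [← Nat.cast_le (α := ℝ)]
      rcases eq_or_lt_of_le hk'.2 with rfl | hlt
      · have h1 := coord_add hn (fun i => (c i : ℝ))
        have h2 := coord_add hn (fun i => (d i : ℝ))
        have := weight_le_of_prec h (p := Sum.inl ⟨k - 1, by simp; omega⟩)
          (q := Sum.inr ⟨k, hI hk⟩) (by simp; omega) (Int.natCast_nonneg (c k))
          (by simpa [weight] using h1)
        simp only [weight, Sum.elim_inl, Sum.elim_inr, sub_neg_eq_add, h2] at this
        exact_mod_cast this
      · have h1 := coord_sub (n := n) (fun i => (c i : ℝ)) (k := k) (by simp; omega)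
        have h2 := coord_sub (n := n) (fun i => (d i : ℝ)) (k := k) (by simp; omega)
        have := weight_le_of_prec h (p := Sum.inl ⟨k, hI hk⟩)
          (q := Sum.inl ⟨k + 1, by simp; omega⟩) (by simp) (Int.natCast_nonneg (c k))
          (by simpa [weight] using h1)
        simp only [weight, Sum.elim_inl, h2] at this
        exact_mod_cast this
    · have := hd.1 k
      simp only [hk, iff_false, not_not] at this
      rw [this]
      exact Nat.zero_le _
  · intro h
    obtain ⟨w, hw, -⟩ := hd.2
    obtain ⟨m, hm⟩ := exists_int_coord hn hw
    have hle : ∀ k, (d k : ℝ) ≤ c k := fun k => by exact_mod_cast h k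
    refine prec_of_roots hm (fun i j => posRoots_nonneg ?_ ?_) fun i j hi hij hj => ?_
    · intro k hk
      have h1 := coord_sub (fun i => (d i : ℝ)) hk
      have : (0 : ℝ) ≤ d k := Nat.cast_nonneg _
      linarith
    · rw [coord_add hn]
      exact Nat.cast_nonneg _
    · have := posRoots_nonneg (n := n)
        (a := coord n (fun i => (c i : ℝ)) - coord n (fun i => (d i : ℝ))) ?_ ?_ hi hij hj
      · simp only [Pi.sub_apply] at this
        constructor <;> linarith
      · intro k hk
        have h1 := coord_sub (fun i => (d i : ℝ)) hk
        have h2 := coord_sub (fun i => (c i : ℝ)) hk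
        have h3 := hle k
        simp only [Pi.sub_apply]
        linarith
      · have h1 := coord_add hn (fun i => (d i : ℝ))
        have h2 := coord_add hn (fun i => (c i : ℝ))
        have h3 := hle n
        simp only [Pi.sub_apply]
        linarith

theorem isCanonical_iff (hn : 2 ≤ n) {I : Finset ℕ} (hI : I ⊆ Finset.Icc 1 n) {ξ : Mat n} :
    IsCanonical n I ξ ↔ ∃ c, Minimal (Feasible n I) c ∧ ξ = point n c := by
  constructor
  · rintro ⟨h1, h2⟩
    obtain ⟨c, hc, rfl⟩ := (mem_dominantLattice_inter_cone_iff hn hI).1 h1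
    refine ⟨c, ⟨hc, fun d hd hdc => ?_⟩, rfl⟩
    have := h2 _ ((mem_dominantLattice_inter_cone_iff hn hI).2 ⟨d, hd, rfl⟩)
      ((prec_point_iff hn hI hc hd).2 hdc)
    exact (eq_of_point_eq hn hI hc hd this).le
  · rintro ⟨c, ⟨hc, hmin⟩, rfl⟩
    refine ⟨(mem_dominantLattice_inter_cone_iff hn hI).2 ⟨c, hc, rfl⟩, fun ξ' h hp => ?_⟩
    obtain ⟨d, hd, rfl⟩ := (mem_dominantLattice_inter_cone_iff hn hI).1 h
    have hdc := (prec_point_iff hn hI hc hd).1 hp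
    rw [le_antisymm hdc (hmin hd hdc)]

end

noncomputable section

variable {n : ℕ}

/-! ### Minimal coefficient vectors -/

/-- The parity conditions on the last two coefficients `u`, `v`, when the other ones contribute
`S` to the sum of the coordinates. -/
def TailAdmissible (n : ℕ) (S : ℤ) (u v : ℕ) : Prop :=
  ∃ w : ℤ, (v : ℤ) = u + 2 * w ∧ Even (S + (n - 1) * u + n * w)

theorem TailAdmissible.congr {S S' : ℤ} (h : Even (S - S')) {u v : ℕ}
    (hS : TailAdmissible n S u v) : TailAdmissible n S' u v := by
  obtain ⟨w, hw, he⟩ := hS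
  refine ⟨w, hw, ?_⟩
  have := he.sub h
  rwa [show S + (n - 1) * u + n * w - (S - S') = S' + (n - 1) * u + n * w by ring] at this

/-- For odd `n` the parity is that of `S + w`, where `2w = v - u`; so `v - u` matters mod 4. It is
written `v + 3 * u` to stay in `ℕ`. -/
theorem tailAdmissible_of_odd (hn : Odd n) {S : ℤ} {u v : ℕ} : TailAdmissible n S u v ↔
    (Even S ∧ (v + 3 * u) % 4 = 0) ∨ (Odd S ∧ (v + 3 * u) % 4 = 2) := by
  have key : ∀ w : ℤ, Even (S + (n - 1) * u + n * w) ↔ Even (S + w) := by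
    intro w
    have : ¬ Even (n : ℤ) := by exact_mod_cast Nat.not_even_iff_odd.2 hn
    simp [Int.even_add, Int.even_mul, this, hn]
  simp only [TailAdmissible, key]
  constructor
  · rintro ⟨w, hw, he⟩
    rw [Int.even_iff] at he ⊢
    rw [Int.odd_iff]
    omega
  · intro h
    rw [Int.even_iff, Int.odd_iff] at h
    refine ⟨((v : ℤ) - u) / 2, by omega, ?_⟩
    rw [Int.even_iff]
    omega

/-- For even `n` the term `n w` drops out and the parity is that of `S + u`; `w` only forces `u` and
`v` to have equal parity. -/
theorem tailAdmissible_of_even (hn : Even n) {S : ℤ} {u v : ℕ} : TailAdmissible n S u v ↔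
    (Even S ∧ u % 2 = 0 ∧ v % 2 = 0) ∨ (Odd S ∧ u % 2 = 1 ∧ v % 2 = 1) := by
  have key : ∀ w : ℤ, Even (S + (n - 1) * u + n * w) ↔ Even (S + u) := by
    intro w
    have : Even (n : ℤ) := by exact_mod_cast hn
    simp [Int.even_add, Int.even_mul, this, Nat.not_odd_iff_even.2 hn]
  simp only [TailAdmissible, key]
  constructor
  · rintro ⟨w, hw, he⟩
    rw [Int.even_iff] at he ⊢
    rw [Int.odd_iff]
    omega
  · intro h
    rw [Int.even_iff, Int.odd_iff] at h
    refine ⟨((v : ℤ) - u) / 2, by omega, ?_⟩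
    rw [Int.even_iff]
    omega

/-- The conditions on the last two coefficients of a feasible vector. -/
def TailFeasible (n : ℕ) (I : Finset ℕ) (S : ℤ) (u v : ℕ) : Prop :=
  (u ≠ 0 ↔ n - 1 ∈ I) ∧ (v ≠ 0 ↔ n ∈ I) ∧ TailAdmissible n S u v

/-- The contribution of the first `n - 2` coefficients to the sum of the coordinates. -/
def headSum (n : ℕ) (c : ℕ → ℕ) : ℤ := ∑ i ∈ Finset.Icc 1 (n - 2), (i : ℤ) * c i

theorem Feasible.tail {I : Finset ℕ} {c : ℕ → ℕ} (h : Feasible n I c) :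
    TailFeasible n I (headSum n c) (c (n - 1)) (c n) :=
  ⟨h.1 _, h.1 _, h.2⟩

/-- The vector with coefficients `u` and `v` at `n - 1` and `n`, and with coefficient `1` on the
remaining elements of `I`. -/
def base (n : ℕ) (I : Finset ℕ) (u v : ℕ) (i : ℕ) : ℕ :=
  if i = n - 1 then u else if i = n then v else if i ∈ I then 1 else 0

/-- The vector `base n I u v` with the coefficient at `j` increased by one. -/
def raised (n : ℕ) (I : Finset ℕ) (u v j : ℕ) (i : ℕ) : ℕ :=
  base n I u v i + if i = j then 1 else 0

theorem base_penultimate (I : Finset ℕ) (u v : ℕ) : base n I u v (n - 1) = u := if_pos rfl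

theorem base_last (hn : 2 ≤ n) (I : Finset ℕ) (u v : ℕ) : base n I u v n = v := by
  rw [base, if_neg (by omega), if_pos rfl]

theorem base_of_le {i : ℕ} (hi : i ∈ Finset.Icc 1 (n - 2)) (I : Finset ℕ) (u v : ℕ) :
    base n I u v i = if i ∈ I then 1 else 0 := by
  rw [Finset.mem_Icc] at hi
  rw [base, if_neg (by omega), if_neg (by omega)]

theorem headSum_base (I : Finset ℕ) (u v : ℕ) :
    headSum n (base n I u v) = ((∑ i ∈ I ∩ Finset.Icc 1 (n - 2), i : ℕ) : ℤ) := by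
  rw [headSum, Finset.inter_comm, ← Finset.filter_mem_eq_inter, Finset.sum_filter, Nat.cast_sum]
  refine Finset.sum_congr rfl fun i hi => ?_
  rw [base_of_le hi]
  split_ifs <;> simp

theorem headSum_raised (I : Finset ℕ) (u v : ℕ) {j : ℕ} (hj : j ∈ Finset.Icc 1 (n - 2)) :
    headSum n (raised n I u v j) = headSum n (base n I u v) + j := by
  simp only [headSum, raised, Nat.cast_add, mul_add, Finset.sum_add_distrib]
  simp [hj]

theorem feasible_base (hn : 2 ≤ n) {I : Finset ℕ} {u v : ℕ}
    (h : TailFeasible n I ((∑ i ∈ I ∩ Finset.Icc 1 (n - 2), i : ℕ) : ℤ) u v) :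
    Feasible n I (base n I u v) := by
  refine ⟨fun i => ?_, ?_⟩
  · unfold base
    split_ifs with h1 h2 h3
    · rw [h1]; exact h.1
    · rw [h2]; exact h.2.1
    · simpa using h3
    · simpa using h3
  · have := h.2.2
    rw [← headSum_base I u v] at this
    simp only [Admissible, base_penultimate, base_last hn]
    exact this

theorem feasible_raised (hn : 2 ≤ n) {I : Finset ℕ} {u v j : ℕ}
    (hj : j ∈ I ∩ Finset.Icc 1 (n - 2)) (hjo : Odd j)
    (h : TailFeasible n I ((∑ i ∈ I ∩ Finset.Icc 1 (n - 2), i : ℕ) + 1 : ℤ) u v) :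
    Feasible n I (raised n I u v j) := by
  obtain ⟨hjI, hj'⟩ := Finset.mem_inter.1 hj
  have hj'' := Finset.mem_Icc.1 hj'
  refine ⟨fun i => ?_, ?_⟩
  · unfold raised
    by_cases hij : i = j
    · simp [hij, hjI]
    · simp only [hij, if_false, add_zero]
      unfold base
      split_ifs with h1 h2 h3
      · rw [h1]; exact h.1
      · rw [h2]; exact h.2.1
      · simpa using h3
      · simpa using h3
  · have e : TailAdmissible n (headSum n (raised n I u v j)) u v := by
      refine h.2.2.congr ?_
      rw [headSum_raised I u v hj', headSum_base]
      obtain ⟨k, rfl⟩ := hjo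
      exact ⟨-k, by push_cast; ring⟩
    have e1 : raised n I u v j (n - 1) = u := by
      rw [raised, base_penultimate, if_neg (by omega), add_zero]
    have e2 : raised n I u v j n = v := by
      rw [raised, base_last hn, if_neg (by omega), add_zero]
    simp only [Admissible, e1, e2]
    exact e

theorem base_le {I : Finset ℕ} {c : ℕ → ℕ} (hc : Feasible n I c) {u v : ℕ}
    (hu : u ≤ c (n - 1)) (hv : v ≤ c n) : base n I u v ≤ c := by
  intro i
  unfold base
  split_ifs with h1 h2 h3
  · rwa [h1]
  · rwa [h2]
  · exact Nat.one_le_iff_ne_zero.2 ((hc.1 i).2 h3)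
  · exact Nat.zero_le _

/-- A feasible vector whose head has the same parity as that of `base` has an admissible tail for
that parity; otherwise one of the coefficients with odd index exceeds one. -/
theorem Feasible.parity {I : Finset ℕ} {c : ℕ → ℕ} (hc : Feasible n I c) :
    TailFeasible n I ((∑ i ∈ I ∩ Finset.Icc 1 (n - 2), i : ℕ) : ℤ) (c (n - 1)) (c n) ∨
    (TailFeasible n I ((∑ i ∈ I ∩ Finset.Icc 1 (n - 2), i : ℕ) + 1 : ℤ) (c (n - 1)) (c n) ∧
      ∃ j ∈ I ∩ Finset.Icc 1 (n - 2), Odd j ∧ 2 ≤ c j) := by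
  obtain ⟨h1, h2, h3⟩ := hc.tail
  have e := headSum_base (n := n) I (c (n - 1)) (c n)
  rcases Int.even_or_odd (headSum n c - headSum n (base n I (c (n - 1)) (c n))) with he | ho
  · left
    rw [e] at he
    exact ⟨h1, h2, h3.congr he⟩
  · right
    refine ⟨⟨h1, h2, h3.congr ?_⟩, ?_⟩
    · rw [e] at ho
      rw [← sub_sub]
      exact ho.sub_odd odd_one
    -- If every odd-index coefficient on `I` were `1`, each term `i (c_i - base_i)` would be even.
    · by_contra! hcon
      refine Int.not_even_iff_odd.2 ho ?_
      rw [headSum, headSum, ← Finset.sum_sub_distrib]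
      refine Finset.sum_induction _ Even (fun _ _ => Even.add) Even.zero fun i hi => ?_
      rw [base_of_le hi, ← mul_sub]
      by_cases hiI : i ∈ I
      · rcases Nat.even_or_odd i with hie | hio
        · exact Even.mul_right (by exact_mod_cast hie) _
        · have h4 := hcon i (Finset.mem_inter.2 ⟨hiI, hi⟩) hio
          have h5 := (hc.1 i).2 hiI
          have h6 : c i = 1 := by omega
          simp [hiI, h6]
      · have h5 := hc.1 i
        simp only [hiI, iff_false, not_not] at h5
        simp [hiI, h5]

theorem raised_le {I : Finset ℕ} {c : ℕ → ℕ} (hc : Feasible n I c) {u v j : ℕ}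
    (hj : j ∈ I ∩ Finset.Icc 1 (n - 2)) (hu : u ≤ c (n - 1)) (hv : v ≤ c n) (hcj : 2 ≤ c j) :
    raised n I u v j ≤ c := by
  intro i
  obtain ⟨hjI, hj'⟩ := Finset.mem_inter.1 hj
  unfold raised
  by_cases hij : i = j
  · subst hij
    rw [base_of_le hj', if_pos hjI, if_pos rfl]
    exact hcj
  · rw [if_neg hij]
    exact base_le hc hu hv i

/-- By `Feasible.parity` every feasible vector lies above a feasible `base` or `raised` vector with
the same tail. A `raised` vector is minimal only if no tail of parity `σ` fits below its own, since
the corresponding `base` vector would be strictly smaller. Raised vectors with different `j` are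
incomparable. -/
theorem minimal_feasible_iff (hn : 2 ≤ n) {I : Finset ℕ} {σ : ℤ}
    (hσ : σ = ((∑ i ∈ I ∩ Finset.Icc 1 (n - 2), i : ℕ) : ℤ)) {c : ℕ → ℕ} :
    Minimal (Feasible n I) c ↔
      (∃ u v, (TailFeasible n I σ u v ∧
          ∀ u' ≤ u, ∀ v' ≤ v, TailFeasible n I σ u' v' → u' = u ∧ v' = v) ∧
        c = base n I u v) ∨
      (∃ j ∈ I ∩ Finset.Icc 1 (n - 2), Odd j ∧ ∃ u v, (TailFeasible n I (σ + 1) u v ∧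
          (∀ u' ≤ u, ∀ v' ≤ v, TailFeasible n I (σ + 1) u' v' → u' = u ∧ v' = v) ∧
          ∀ u' ≤ u, ∀ v' ≤ v, ¬ TailFeasible n I σ u' v') ∧
        c = raised n I u v j) := by
  subst hσ
  constructor
  · rintro ⟨hc, hmin⟩
    rcases hc.parity with h | ⟨h, j, hj, hjo, hcj⟩
    · left
      refine ⟨c (n - 1), c n, ⟨h, fun u' hu v' hv h' => ?_⟩, ?_⟩
      · have := hmin (feasible_base hn h') (base_le hc hu hv)
        have h1 := this (n - 1)
        have h2 := this n
        rw [base_penultimate] at h1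
        rw [base_last hn] at h2
        exact ⟨le_antisymm hu h1, le_antisymm hv h2⟩
      · have hle := base_le hc (le_refl (c (n - 1))) (le_refl (c n))
        exact le_antisymm (hmin (feasible_base hn h) hle) hle
    · right
      have hj' := Finset.mem_Icc.1 (Finset.mem_inter.1 hj).2
      refine ⟨j, hj, hjo, c (n - 1), c n, ⟨h, fun u' hu v' hv h' => ?_,
        fun u' hu v' hv h' => ?_⟩, ?_⟩
      · have := hmin (feasible_raised hn hj hjo h') (raised_le hc hj hu hv hcj)
        have h1 := this (n - 1)
        have h2 := this n
        rw [raised, base_penultimate, if_neg (by omega)] at h1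
        rw [raised, base_last hn, if_neg (by omega)] at h2
        exact ⟨le_antisymm hu h1, le_antisymm hv h2⟩
      · have := hmin (feasible_base hn h') (base_le hc hu hv) j
        rw [base_of_le (Finset.mem_inter.1 hj).2, if_pos (Finset.mem_inter.1 hj).1] at this
        exact absurd (hcj.trans this) (by norm_num)
      · have hle := raised_le hc hj (le_refl (c (n - 1))) (le_refl (c n)) hcj
        exact le_antisymm (hmin (feasible_raised hn hj hjo h) hle) hle
  · rintro (⟨u, v, ⟨h, hmin⟩, rfl⟩ | ⟨j, hj, hjo, u, v, ⟨h, hmin1, hmin0⟩, rfl⟩)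
    · refine ⟨feasible_base hn h, fun d hd hdc => ?_⟩
      have h1 := hdc (n - 1)
      have h2 := hdc n
      rw [base_penultimate] at h1
      rw [base_last hn] at h2
      rcases hd.parity with h' | ⟨h', j, hj, hjo, hdj⟩
      · obtain ⟨e1, e2⟩ := hmin _ h1 _ h2 h'
        exact base_le hd e1.ge e2.ge
      · have := hdc j
        rw [base_of_le (Finset.mem_inter.1 hj).2, if_pos (Finset.mem_inter.1 hj).1] at this
        exact absurd (hdj.trans this) (by norm_num)
    · refine ⟨feasible_raised hn hj hjo h, fun d hd hdc => ?_⟩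
      have hj' := Finset.mem_Icc.1 (Finset.mem_inter.1 hj).2
      have h1 := hdc (n - 1)
      have h2 := hdc n
      rw [raised, base_penultimate, if_neg (by omega)] at h1
      rw [raised, base_last hn, if_neg (by omega)] at h2
      rcases hd.parity with h' | ⟨h', k, hk, hko, hdk⟩
      · exact absurd h' (hmin0 _ h1 _ h2)
      · have h3 := hdc k
        rw [raised, base_of_le (Finset.mem_inter.1 hk).2, if_pos (Finset.mem_inter.1 hk).1] at h3
        have hkj : k = j := by
          by_contra hne
          rw [if_neg hne] at h3
          exact absurd (hdk.trans h3) (by norm_num)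
        subst hkj
        obtain ⟨e1, e2⟩ := hmin1 _ h1 _ h2 h'
        exact raised_le hd hj e1.ge e2.ge hdk

theorem point_eq_sum (hn : 2 ≤ n) (c : ℕ → ℕ) :
    point n c = ∑ i ∈ Finset.Icc 1 n, c i • H n i := by
  rw [point, ← sum_smul_H hn]
  exact Finset.sum_congr rfl fun i _ => Nat.cast_smul_eq_nsmul ℝ _ _

theorem point_base (hn : 2 ≤ n) (I : Finset ℕ) (u v : ℕ) : point n (base n I u v) =
    ∑ i ∈ I ∩ Finset.Icc 1 (n - 2), H n i + u • H n (n - 1) + v • H n n := by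
  rw [point_eq_sum hn]
  have hsplit : ∀ f : ℕ → Mat n, ∑ i ∈ Finset.Icc 1 n, f i =
      ∑ i ∈ Finset.Icc 1 (n - 2), f i + f (n - 1) + f n := by
    intro f
    obtain ⟨m, rfl⟩ := Nat.exists_eq_add_of_le' hn
    rw [Finset.sum_Icc_succ_top (by omega), Finset.sum_Icc_succ_top (by omega)]
    rfl
  rw [hsplit, base_penultimate, base_last hn, Finset.inter_comm, ← Finset.filter_mem_eq_inter,
    Finset.sum_filter]
  congr 2
  refine Finset.sum_congr rfl fun i hi => ?_
  rw [base_of_le hi]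
  split_ifs <;> simp

theorem point_raised (hn : 2 ≤ n) (I : Finset ℕ) (u v : ℕ) {j : ℕ} (hj : j ∈ Finset.Icc 1 n) :
    point n (raised n I u v j) = point n (base n I u v) + H n j := by
  simp only [point_eq_sum hn, raised, add_smul, Finset.sum_add_distrib, ite_smul, one_smul,
    zero_smul]
  rw [Finset.sum_ite_eq', if_pos hj]

theorem isCanonical_iff_tail (hn : 2 ≤ n) {I I₀ : Finset ℕ} (hI : I ⊆ Finset.Icc 1 n)
    (hI₀ : I₀ = I ∩ Finset.Icc 1 (n - 2)) {ξ : Mat n} :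
    IsCanonical n I ξ ↔
      (∃ u v, (TailFeasible n I (∑ i ∈ I₀, i : ℕ) u v ∧
          ∀ u' ≤ u, ∀ v' ≤ v, TailFeasible n I (∑ i ∈ I₀, i : ℕ) u' v' → u' = u ∧ v' = v) ∧
        ξ = ∑ i ∈ I₀, H n i + u • H n (n - 1) + v • H n n) ∨
      (∃ j ∈ I₀, Odd j ∧ ∃ u v, (TailFeasible n I ((∑ i ∈ I₀, i : ℕ) + 1) u v ∧
          (∀ u' ≤ u, ∀ v' ≤ v, TailFeasible n I ((∑ i ∈ I₀, i : ℕ) + 1) u' v' →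
            u' = u ∧ v' = v) ∧
          ∀ u' ≤ u, ∀ v' ≤ v, ¬ TailFeasible n I (∑ i ∈ I₀, i : ℕ) u' v') ∧
        ξ = ∑ i ∈ I₀, H n i + u • H n (n - 1) + v • H n n + H n j) := by
  subst hI₀
  rw [isCanonical_iff hn hI]
  simp only [minimal_feasible_iff hn rfl]
  constructor
  · rintro ⟨c, ⟨u, v, h, rfl⟩ | ⟨j, hj, hjo, u, v, h, rfl⟩, rfl⟩
    · exact Or.inl ⟨u, v, h, point_base hn I u v⟩
    · exact Or.inr ⟨j, hj, hjo, u, v, h, by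
        rw [point_raised hn I u v (hI (Finset.mem_inter.1 hj).1), point_base hn]⟩
  · rintro (⟨u, v, h, rfl⟩ | ⟨j, hj, hjo, u, v, h, rfl⟩)
    · exact ⟨_, Or.inl ⟨u, v, h, rfl⟩, (point_base hn I u v).symm⟩
    · exact ⟨_, Or.inr ⟨j, hj, hjo, u, v, h, rfl⟩, by
        rw [point_raised hn I u v (hI (Finset.mem_inter.1 hj).1), point_base hn]⟩

theorem xi_eq (hn : 2 ≤ n) {I I₀ T : Finset ℕ} (hI : I ⊆ Finset.Icc 1 n)
    (hI₀ : I₀ = I ∩ Finset.Icc 1 (n - 2)) (hT : T = I ∩ {n - 1, n}) :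
    xi n I = ∑ i ∈ I₀, H n i + ∑ i ∈ T, H n i := by
  have hd : Disjoint I₀ T := by
    rw [Finset.disjoint_left, hI₀, hT]
    intro i h1 h2
    simp only [Finset.mem_inter, Finset.mem_Icc, Finset.mem_insert, Finset.mem_singleton] at h1 h2
    omega
  rw [← Finset.sum_union hd, xi]
  congr 1
  ext i
  have := @hI i
  simp only [hI₀, hT, Finset.mem_union, Finset.mem_inter, Finset.mem_Icc, Finset.mem_insert,
    Finset.mem_singleton] at this ⊢
  constructor
  · intro h
    have := this h
    by_cases h1 : i ≤ n - 2
    · exact Or.inl ⟨h, by omega⟩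
    · exact Or.inr ⟨h, by omega⟩
  · rintro (h | h) <;> exact h.1

end

noncomputable section

variable {n : ℕ} {I I₀ T : Finset ℕ} {ξ : Mat n}

/-! ### The shapes of the set of canonical elements -/

/-- The case where one tail of the parity of `∑ I₀` lies below all tails of both parities, so that
raising never gives a minimal vector. -/
theorem isCanonical_iff_base (hn : 2 ≤ n) (hI : I ⊆ Finset.Icc 1 n)
    (hI₀ : I₀ = I ∩ Finset.Icc 1 (n - 2)) {x y : ℕ}
    (hxy : TailFeasible n I (∑ i ∈ I₀, i : ℕ) x y)
    (h0 : ∀ u v, TailFeasible n I (∑ i ∈ I₀, i : ℕ) u v → x ≤ u ∧ y ≤ v)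
    (h1 : ∀ u v, TailFeasible n I ((∑ i ∈ I₀, i : ℕ) + 1) u v → x ≤ u ∧ y ≤ v)
    {Z : Mat n} (hZ : ∑ i ∈ I₀, H n i + x • H n (n - 1) + y • H n n = Z) :
    IsCanonical n I ξ ↔ ξ = Z := by
  rw [isCanonical_iff_tail hn hI hI₀]
  constructor
  · rintro (⟨u, v, ⟨h, hm⟩, rfl⟩ | ⟨j, -, -, u, v, ⟨h, -, hm⟩, -⟩)
    · obtain ⟨rfl, rfl⟩ := hm x (h0 u v h).1 y (h0 u v h).2 hxy
      exact hZ
    · exact absurd hxy (hm x (h1 u v h).1 y (h1 u v h).2)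
  · rintro rfl
    refine Or.inl ⟨x, y, ⟨hxy, fun u hu v hv h => ?_⟩, hZ.symm⟩
    exact ⟨le_antisymm hu (h0 u v h).1, le_antisymm hv (h0 u v h).2⟩

/-- If `(x, y)` is the least tail of the opposite parity, and no tail of the parity of `∑ I₀` lies
below it, then the canonical elements are the raised ones together with those whose tail is minimal
for the parity of `∑ I₀`. -/
theorem isCanonical_iff_raised (hn : 2 ≤ n) (hI : I ⊆ Finset.Icc 1 n)
    (hI₀ : I₀ = I ∩ Finset.Icc 1 (n - 2)) {x y : ℕ}
    (hxy : TailFeasible n I ((∑ i ∈ I₀, i : ℕ) + 1) x y)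
    (h1 : ∀ u v, TailFeasible n I ((∑ i ∈ I₀, i : ℕ) + 1) u v → x ≤ u ∧ y ≤ v)
    (h0 : ∀ u v, TailFeasible n I (∑ i ∈ I₀, i : ℕ) u v → ¬ (u ≤ x ∧ v ≤ y))
    {Z : ℕ → Mat n}
    (hZ : ∀ j, ∑ i ∈ I₀, H n i + x • H n (n - 1) + y • H n n + H n j = Z j) :
    IsCanonical n I ξ ↔
      (∃ u v, (TailFeasible n I (∑ i ∈ I₀, i : ℕ) u v ∧
          ∀ u' ≤ u, ∀ v' ≤ v, TailFeasible n I (∑ i ∈ I₀, i : ℕ) u' v' → u' = u ∧ v' = v) ∧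
        ξ = ∑ i ∈ I₀, H n i + u • H n (n - 1) + v • H n n) ∨
      ∃ j ∈ I₀, Odd j ∧ ξ = Z j := by
  rw [isCanonical_iff_tail hn hI hI₀]
  refine or_congr_right (exists_congr fun j => and_congr_right fun _ => and_congr_right fun _ => ?_)
  constructor
  · rintro ⟨u, v, ⟨h, hm, -⟩, rfl⟩
    obtain ⟨rfl, rfl⟩ := hm x (h1 u v h).1 y (h1 u v h).2 hxy
    exact hZ j
  · rintro rfl
    refine ⟨x, y, ⟨hxy, fun u hu v hv h => ?_, fun u hu v hv h => h0 u v h ⟨hu, hv⟩⟩, (hZ j).symm⟩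
    exact ⟨le_antisymm hu (h1 u v h).1, le_antisymm hv (h1 u v h).2⟩

theorem isCanonical_iff_raised_only (hn : 2 ≤ n) (hI : I ⊆ Finset.Icc 1 n)
    (hI₀ : I₀ = I ∩ Finset.Icc 1 (n - 2)) {x y : ℕ}
    (hxy : TailFeasible n I ((∑ i ∈ I₀, i : ℕ) + 1) x y)
    (h1 : ∀ u v, TailFeasible n I ((∑ i ∈ I₀, i : ℕ) + 1) u v → x ≤ u ∧ y ≤ v)
    (h0 : ∀ u v, ¬ TailFeasible n I (∑ i ∈ I₀, i : ℕ) u v)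
    {Z : ℕ → Mat n}
    (hZ : ∀ j, ∑ i ∈ I₀, H n i + x • H n (n - 1) + y • H n n + H n j = Z j) :
    IsCanonical n I ξ ↔ ∃ j ∈ I₀, Odd j ∧ ξ = Z j := by
  rw [isCanonical_iff_raised hn hI hI₀ hxy h1 (fun u v h => absurd h (h0 u v)) hZ]
  exact or_iff_right fun ⟨u, v, h, _⟩ => h0 u v h.1

/-- Each parity has a least tail, and the one for the parity of `∑ I₀` is not below the other, so
both kinds of vector survive. -/
theorem isCanonical_iff_base_or_raised (hn : 2 ≤ n) (hI : I ⊆ Finset.Icc 1 n)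
    (hI₀ : I₀ = I ∩ Finset.Icc 1 (n - 2)) {x y x' y' : ℕ}
    (hxy : TailFeasible n I ((∑ i ∈ I₀, i : ℕ) + 1) x y)
    (h1 : ∀ u v, TailFeasible n I ((∑ i ∈ I₀, i : ℕ) + 1) u v → x ≤ u ∧ y ≤ v)
    (hxy' : TailFeasible n I (∑ i ∈ I₀, i : ℕ) x' y')
    (h0 : ∀ u v, TailFeasible n I (∑ i ∈ I₀, i : ℕ) u v → (x' ≤ u ∧ y' ≤ v) ∧ ¬ (u ≤ x ∧ v ≤ y))
    {Z : ℕ → Mat n} {Z' : Mat n}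
    (hZ' : ∑ i ∈ I₀, H n i + x' • H n (n - 1) + y' • H n n = Z')
    (hZ : ∀ j, ∑ i ∈ I₀, H n i + x • H n (n - 1) + y • H n n + H n j = Z j) :
    IsCanonical n I ξ ↔ ξ = Z' ∨ ∃ j ∈ I₀, Odd j ∧ ξ = Z j := by
  rw [isCanonical_iff_raised hn hI hI₀ hxy h1 (fun u v h => (h0 u v h).2) hZ]
  refine or_congr_left ⟨?_, ?_⟩
  · rintro ⟨u, v, ⟨h, hm⟩, rfl⟩
    obtain ⟨rfl, rfl⟩ := hm x' (h0 u v h).1.1 y' (h0 u v h).1.2 hxy'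
    exact hZ'
  · rintro rfl
    refine ⟨x', y', ⟨hxy', fun u hu v hv h => ?_⟩, hZ'.symm⟩
    exact ⟨le_antisymm hu (h0 u v h).1.1, le_antisymm hv (h0 u v h).1.2⟩

/-! ### The possible tails of `I` -/

theorem of_card_eq_zero (hT : T = I ∩ {n - 1, n}) (h : T.card = 0) :
    n - 1 ∉ I ∧ n ∉ I ∧ T = ∅ := by
  have hT' := Finset.card_eq_zero.1 h
  refine ⟨fun h1 => ?_, fun h1 => ?_, hT'⟩
  · have : n - 1 ∈ T := by simp [hT, h1]
    simp [hT'] at this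
  · have : n ∈ T := by simp [hT, h1]
    simp [hT'] at this

theorem of_card_eq_one (hn : 2 ≤ n) (hT : T = I ∩ {n - 1, n}) (h : T.card = 1) :
    (n - 1 ∈ I ∧ n ∉ I ∧ T = {n - 1}) ∨ (n - 1 ∉ I ∧ n ∈ I ∧ T = {n}) := by
  obtain ⟨s, hs⟩ := Finset.card_eq_one.1 h
  have hmem : ∀ t, (t ∈ I ∧ (t = n - 1 ∨ t = n)) ↔ t = s := by
    intro t
    have : t ∈ T ↔ t ∈ T := Iff.rfl
    nth_rewrite 1 [hT] at this
    simpa [hs] using this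
  obtain ⟨h1, rfl | rfl⟩ := (hmem s).2 rfl
  · refine Or.inl ⟨h1, fun h2 => ?_, hs⟩
    have := (hmem n).1 ⟨h2, Or.inr rfl⟩
    omega
  · refine Or.inr ⟨fun h2 => ?_, h1, hs⟩
    have := (hmem _).1 ⟨h2, Or.inl rfl⟩
    omega

theorem of_card_eq_two (hT : T = I ∩ {n - 1, n}) (h : T.card = 2) :
    n - 1 ∈ I ∧ n ∈ I ∧ T = {n - 1, n} := by
  have hsub : T ⊆ {n - 1, n} := hT ▸ Finset.inter_subset_right
  have hT' : T = {n - 1, n} := Finset.eq_of_subset_of_card_le hsub (h ▸ Finset.card_le_two)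
  have hTI : T ⊆ I := hT ▸ Finset.inter_subset_left
  exact ⟨hTI (by simp [hT']), hTI (by simp [hT']), hT'⟩

end

end SpinCanonical

/-! ### Minimal tails in each case. -/

open SpinCanonical in
theorem mainTheorem5 (n : ℕ) (hn : 2 ≤ n) (I I₀ T : Finset ℕ) (hI : I ⊆ Finset.Icc 1 n)
    (hI₀ : I₀ = I ∩ Finset.Icc 1 (n - 2)) (hT : T = I ∩ {n - 1, n})
    (ξ : SpinCanonical.Mat n) :
    (Odd n →
      (Even (∑ i ∈ I₀, i) →
        (T.card = 0 → (SpinCanonical.IsCanonical n I ξ ↔ ξ = SpinCanonical.xi n I)) ∧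
        (T.card = 1 → (SpinCanonical.IsCanonical n I ξ ↔
          (∃ s ∈ T, ξ = SpinCanonical.xi n I + 3 • SpinCanonical.H n s) ∨
          (∃ s ∈ T, ∃ j ∈ I₀, Odd j ∧
            ξ = SpinCanonical.xi n I + (SpinCanonical.H n s + SpinCanonical.H n j)))) ∧
        (T.card = 2 → (SpinCanonical.IsCanonical n I ξ ↔ ξ = SpinCanonical.xi n I))) ∧
      (Odd (∑ i ∈ I₀, i) →
        (T.card = 0 → (SpinCanonical.IsCanonical n I ξ ↔
          ∃ j ∈ I₀, Odd j ∧ ξ = SpinCanonical.xi n I + SpinCanonical.H n j)) ∧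
        (T.card = 1 → (SpinCanonical.IsCanonical n I ξ ↔
          ∃ s ∈ T, ξ = SpinCanonical.xi n I + SpinCanonical.H n s)) ∧
        (T.card = 2 → (SpinCanonical.IsCanonical n I ξ ↔
          (∃ s ∈ T, ξ = SpinCanonical.xi n I + 2 • SpinCanonical.H n s) ∨
          (∃ j ∈ I₀, Odd j ∧ ξ = SpinCanonical.xi n I + SpinCanonical.H n j))))) ∧
    (Even n →
      (Even (∑ i ∈ I₀, i) →
        (T.card = 0 → (SpinCanonical.IsCanonical n I ξ ↔ ξ = SpinCanonical.xi n I)) ∧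
        (T.card = 1 → (SpinCanonical.IsCanonical n I ξ ↔
          ∃ s ∈ T, ξ = SpinCanonical.xi n I + SpinCanonical.H n s)) ∧
        (T.card = 2 → (SpinCanonical.IsCanonical n I ξ ↔
          (∃ j ∈ I₀, Odd j ∧ ξ = SpinCanonical.xi n I + SpinCanonical.H n j) ∨
          ξ = SpinCanonical.xi n I + (SpinCanonical.H n (n - 1) + SpinCanonical.H n n)))) ∧
      (Odd (∑ i ∈ I₀, i) →
        (T.card = 0 → (SpinCanonical.IsCanonical n I ξ ↔
          ∃ j ∈ I₀, Odd j ∧ ξ = SpinCanonical.xi n I + SpinCanonical.H n j)) ∧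
        (T.card = 1 → (SpinCanonical.IsCanonical n I ξ ↔
          ∃ s ∈ T, ∃ j ∈ I₀, Odd j ∧
            ξ = SpinCanonical.xi n I + (SpinCanonical.H n s + SpinCanonical.H n j))) ∧
        (T.card = 2 → (SpinCanonical.IsCanonical n I ξ ↔ ξ = SpinCanonical.xi n I)))) := by
  have hne : n - 1 ≠ n := by omega
  rw [xi_eq hn hI hI₀ hT]
  have q0 : ∀ u v, TailFeasible n I (∑ i ∈ I₀, i : ℕ) u v ↔ (u ≠ 0 ↔ n - 1 ∈ I) ∧
    (v ≠ 0 ↔ n ∈ I) ∧ TailAdmissible n (∑ i ∈ I₀, i : ℕ) u v := fun _ _ => Iff.rfl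
  have q1 : ∀ u v, TailFeasible n I ((∑ i ∈ I₀, i : ℕ) + 1) u v ↔ (u ≠ 0 ↔ n - 1 ∈ I) ∧
    (v ≠ 0 ↔ n ∈ I) ∧ TailAdmissible n ((∑ i ∈ I₀, i : ℕ) + 1) u v := fun _ _ => Iff.rfl
  have even_cast : Even (((∑ i ∈ I₀, i : ℕ)) : ℤ) ↔ Even (∑ i ∈ I₀, i) := Int.even_coe_nat _
  have odd_cast : Odd (((∑ i ∈ I₀, i : ℕ)) : ℤ) ↔ Odd (∑ i ∈ I₀, i) := Int.odd_coe_nat _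
  have even_succ : Even (((∑ i ∈ I₀, i : ℕ) + 1 : ℤ)) ↔ Odd (∑ i ∈ I₀, i) := by
    rw [Int.even_add_one, even_cast, Nat.not_even_iff_odd]
  have odd_succ : Odd (((∑ i ∈ I₀, i : ℕ) + 1 : ℤ)) ↔ Even (∑ i ∈ I₀, i) := by
    rw [← Int.not_even_iff_odd, even_succ, Nat.not_odd_iff_even]
  refine ⟨fun hpn => ?_, fun hpn => ?_⟩
  · simp only [tailAdmissible_of_odd hpn, even_cast, odd_cast, even_succ, odd_succ] at q0 q1
    refine ⟨fun hs => ?_, fun hs => ?_⟩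
    · simp only [hs, Nat.not_odd_iff_even.2 hs, true_and, false_and, or_false, false_or] at q0 q1
      refine ⟨fun h => ?_, fun h => ?_, fun h => ?_⟩
      · obtain ⟨m1, m2, rfl⟩ := of_card_eq_zero hT h
        simp only [m1, m2, iff_false, not_not] at q0 q1
        refine isCanonical_iff_base hn hI hI₀ (x := 0) (y := 0) (by rw [q0]; omega)
          (fun u v h => by rw [q0] at h; omega) (fun u v h => by rw [q1] at h; omega) (by simp)
      · obtain ⟨m1, m2, rfl⟩ | ⟨m1, m2, rfl⟩ := of_card_eq_one hn hT h <;>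
          simp only [m1, m2, iff_true, iff_false, not_not] at q0 q1 <;>
          simp only [Finset.mem_singleton, exists_eq_left, Finset.sum_singleton]
        -- The nonzero coefficient is `0` mod 4 without raising and `2` mod 4 with it. The least
        -- values `4` and `2` include the `1` already present in `ξ_I`.
        · refine isCanonical_iff_base_or_raised hn hI hI₀ (x := 2) (y := 0) (x' := 4) (y' := 0)
            (by rw [q1]; omega) (fun u v h => by rw [q1] at h; omega) (by rw [q0]; omega)
            (fun u v h => by rw [q0] at h; omega) (by module) (fun j => by module)
        · refine isCanonical_iff_base_or_raised hn hI hI₀ (x := 0) (y := 2) (x' := 0) (y' := 4)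
            (by rw [q1]; omega) (fun u v h => by rw [q1] at h; omega) (by rw [q0]; omega)
            (fun u v h => by rw [q0] at h; omega) (by module) (fun j => by module)
      · obtain ⟨m1, m2, rfl⟩ := of_card_eq_two hT h
        simp only [m1, m2, iff_true] at q0 q1
        rw [Finset.sum_pair hne]
        refine isCanonical_iff_base hn hI hI₀ (x := 1) (y := 1) (by rw [q0]; omega)
          (fun u v h => by rw [q0] at h; omega) (fun u v h => by rw [q1] at h; omega) (by module)
    · simp only [hs, Nat.not_even_iff_odd.2 hs, true_and, false_and, or_false, false_or] at q0 q1
      refine ⟨fun h => ?_, fun h => ?_, fun h => ?_⟩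
      · obtain ⟨m1, m2, rfl⟩ := of_card_eq_zero hT h
        simp only [m1, m2, iff_false, not_not] at q0 q1
        refine isCanonical_iff_raised_only hn hI hI₀ (x := 0) (y := 0) (by rw [q1]; omega)
          (fun u v h => by rw [q1] at h; omega) (fun u v h => by rw [q0] at h; omega)
          (fun j => by simp)
      · obtain ⟨m1, m2, rfl⟩ | ⟨m1, m2, rfl⟩ := of_card_eq_one hn hT h <;>
          simp only [m1, m2, iff_true, iff_false, not_not] at q0 q1 <;>
          simp only [Finset.mem_singleton, exists_eq_left, Finset.sum_singleton]
        · refine isCanonical_iff_base hn hI hI₀ (x := 2) (y := 0) (by rw [q0]; omega)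
            (fun u v h => by rw [q0] at h; omega) (fun u v h => by rw [q1] at h; omega) (by module)
        · refine isCanonical_iff_base hn hI hI₀ (x := 0) (y := 2) (by rw [q0]; omega)
            (fun u v h => by rw [q0] at h; omega) (fun u v h => by rw [q1] at h; omega) (by module)
      · obtain ⟨m1, m2, rfl⟩ := of_card_eq_two hT h
        simp only [m1, m2, iff_true] at q0 q1
        rw [Finset.sum_pair hne]
        rw [isCanonical_iff_raised hn hI hI₀ (x := 1) (y := 1) (by rw [q1]; omega)
          (fun u v h => by rw [q1] at h; omega) (fun u v h => by rw [q0] at h; omega)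
          (Z := fun j => ∑ i ∈ I₀, H n i + (H n (n - 1) + H n n) + H n j) (fun j => by module)]
        -- Positive pairs with `v - u` equal to `2` mod 4 have no least element but two minimal
        -- ones, which give `ξ_I + 2 H_s` for the two choices of `s`.
        have min_iff : ∀ u v, (TailFeasible n I (∑ i ∈ I₀, i : ℕ) u v ∧ ∀ u' ≤ u, ∀ v' ≤ v,
            TailFeasible n I (∑ i ∈ I₀, i : ℕ) u' v' → u' = u ∧ v' = v) ↔
            (u = 3 ∧ v = 1) ∨ (u = 1 ∧ v = 3) := by
          intro u v
          simp only [q0]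
          constructor
          · rintro ⟨h, hm⟩
            by_cases h3 : 3 ≤ u
            · have := hm 3 h3 1 (by omega) (by omega)
              omega
            -- For `u = 2` the congruence forces `4 ≤ v`, so `(1, 3)` lies strictly below.
            · obtain rfl | rfl : u = 1 ∨ u = 2 := by omega
              all_goals
                have := hm 1 (by omega) 3 (by omega) (by omega)
                omega
          · intro h
            exact ⟨by omega, fun u' _ v' _ _ => by omega⟩
        simp only [min_iff, or_and_right, exists_or, and_assoc, exists_eq_left, exists_and_left,
          Finset.mem_insert, Finset.mem_singleton]
        refine or_congr_left (or_congr (Eq.congr_right ?_) (Eq.congr_right ?_)) <;> module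
  · simp only [tailAdmissible_of_even hpn, even_cast, odd_cast, even_succ, odd_succ] at q0 q1
    refine ⟨fun hs => ?_, fun hs => ?_⟩
    · simp only [hs, Nat.not_odd_iff_even.2 hs, true_and, false_and, or_false, false_or] at q0 q1
      refine ⟨fun h => ?_, fun h => ?_, fun h => ?_⟩
      · obtain ⟨m1, m2, rfl⟩ := of_card_eq_zero hT h
        simp only [m1, m2, iff_false, not_not] at q0 q1
        refine isCanonical_iff_base hn hI hI₀ (x := 0) (y := 0) (by rw [q0]; omega)
          (fun u v h => by rw [q0] at h; omega) (fun u v h => by rw [q1] at h; omega) (by simp)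
      · obtain ⟨m1, m2, rfl⟩ | ⟨m1, m2, rfl⟩ := of_card_eq_one hn hT h <;>
          simp only [m1, m2, iff_true, iff_false, not_not] at q0 q1 <;>
          simp only [Finset.mem_singleton, exists_eq_left, Finset.sum_singleton]
        · refine isCanonical_iff_base hn hI hI₀ (x := 2) (y := 0) (by rw [q0]; omega)
            (fun u v h => by rw [q0] at h; omega) (fun u v h => by rw [q1] at h; omega) (by module)
        · refine isCanonical_iff_base hn hI hI₀ (x := 0) (y := 2) (by rw [q0]; omega)
            (fun u v h => by rw [q0] at h; omega) (fun u v h => by rw [q1] at h; omega) (by module)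
      · obtain ⟨m1, m2, rfl⟩ := of_card_eq_two hT h
        simp only [m1, m2, iff_true] at q0 q1
        rw [Finset.sum_pair hne, or_comm]
        -- Without raising both tail coefficients are even and positive, with raising both are odd.
        refine isCanonical_iff_base_or_raised hn hI hI₀ (x := 1) (y := 1) (x' := 2) (y' := 2)
            (by rw [q1]; omega) (fun u v h => by rw [q1] at h; omega) (by rw [q0]; omega)
            (fun u v h => by rw [q0] at h; omega) (by module) (fun j => by module)
    · simp only [hs, Nat.not_even_iff_odd.2 hs, true_and, false_and, or_false, false_or] at q0 q1
      refine ⟨fun h => ?_, fun h => ?_, fun h => ?_⟩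
      · obtain ⟨m1, m2, rfl⟩ := of_card_eq_zero hT h
        simp only [m1, m2, iff_false, not_not] at q0 q1
        refine isCanonical_iff_raised_only hn hI hI₀ (x := 0) (y := 0) (by rw [q1]; omega)
          (fun u v h => by rw [q1] at h; omega) (fun u v h => by rw [q0] at h; omega)
          (fun j => by simp)
      · obtain ⟨m1, m2, rfl⟩ | ⟨m1, m2, rfl⟩ := of_card_eq_one hn hT h <;>
          simp only [m1, m2, iff_true, iff_false, not_not] at q0 q1 <;>
          simp only [Finset.mem_singleton, exists_eq_left, Finset.sum_singleton]
        -- One tail coefficient is `0`, hence both are even; an odd `∑ I₀` then admits no tail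
        -- without raising.
        · refine isCanonical_iff_raised_only hn hI hI₀ (x := 2) (y := 0) (by rw [q1]; omega)
            (fun u v h => by rw [q1] at h; omega) (fun u v h => by rw [q0] at h; omega)
            (fun j => by module)
        · refine isCanonical_iff_raised_only hn hI hI₀ (x := 0) (y := 2) (by rw [q1]; omega)
            (fun u v h => by rw [q1] at h; omega) (fun u v h => by rw [q0] at h; omega)
            (fun j => by module)
      · obtain ⟨m1, m2, rfl⟩ := of_card_eq_two hT h
        simp only [m1, m2, iff_true] at q0 q1
        rw [Finset.sum_pair hne]
        refine isCanonical_iff_base hn hI hI₀ (x := 1) (y := 1) (by rw [q0]; omega)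
          (fun u v h => by rw [q0] at h; omega) (fun u v h => by rw [q1] at h; omega) (by module)
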